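/- Throughout, Banach algebras are complex and need not be unital. For a Banach algebra $A$, the dual $A^*$ is an $A$-bimodule by $\langle a\cdot\varphi,c\rangle=\langle\varphi,ca\rangle$ and $\langle\varphi\cdot a,c\rangle=\langle\varphi,ac\rangle$ $(a,c\in A,\ \varphi\in A^*)$. A bounded linear map $D:A\to A^*$ is a derivation if $D(ab)=D(a)\cdot b+a\cdot D(b)$ for all $a,b\in A$; it is approximately inner if there is a net $(x_i)$ in $A^*$ such that $D(a)=\lim_i(a\cdot x_i-x_i\cdot a)$ in norm for every $a\in A$. The algebra $A$ is approximately weakly amenable if every bounded derivation $D:A\to A^*$ is approximately inner. The first Arens product $\square$ on $A^{**}$ is given by $\langle m\,\square\, n,\varphi\rangle=\langle m,n\cdot\varphi\rangle$, where $\langle n\cdot\varphi,a\rangle=\langle n,\varphi\cdot a\rangle$ $(m,n\in A^{**},\ \varphi\in A^*,\ a\in A)$. Let $G$ be a locally compact (Hausdorff) group. Let $L^1(G)$ be the Banach algebra of (classes of) complex functions integrable with respect to a left Haar measure, with the convolution $(f*g)(x)=\int_G f(s)\,g(s^{-1}x)\,ds$. Let $M(G)$ be the Banach algebra of regular complex Borel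 measures on $G$ with the total variation norm and the convolution determined by $\int_G f\,d(\mu*\nu)=\int_G\int_G f(st)\,d\nu(t)\,d\mu(s)$ for $f\in C_0(G)$. **Theorem.** If $(L^1(G)^{**},\square)$ is approximately weakly amenable, then $M(G)$ is approximately weakly amenable. -/

import Mathlib

set_option linter.unusedSectionVars false

noncomputable section

open MeasureTheory Filter Topology
open scoped ENNReal NNReal ZeroAtInfty

universe u

section Derivations

variable {A : Type u} [NonUnitalNormedRing A] [NormedSpace ℂ A] [IsScalarTower ℂ A A]
  [SMulCommClass ℂ A A]

/-- The left action of `A` on its dual: `⟨a · φ, c⟩ = ⟨φ, c a⟩`. -/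
def dualLeft (a : A) (φ : StrongDual ℂ A) : StrongDual ℂ A :=
  φ.comp ((ContinuousLinearMap.mul ℂ A).flip a)

/-- The right action of `A` on its dual: `⟨φ · a, c⟩ = ⟨φ, a c⟩`. -/
def dualRight (φ : StrongDual ℂ A) (a : A) : StrongDual ℂ A :=
  φ.comp (ContinuousLinearMap.mul ℂ A a)

@[simp] lemma dualLeft_apply (a : A) (φ : StrongDual ℂ A) (c : A) :
    dualLeft a φ c = φ (c * a) := rfl

@[simp] lemma dualRight_apply (φ : StrongDual ℂ A) (a c : A) :
    dualRight φ a c = φ (a * c) := rfl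

/-- `D` satisfies the Leibniz rule `D(ab) = D(a) · b + a · D(b)`. -/
def IsDualDerivation (D : A →L[ℂ] StrongDual ℂ A) : Prop :=
  ∀ a b : A, D (a * b) = dualRight (D a) b + dualLeft a (D b)

/-- There is a net `(x_i)` in the dual of `A` such that, for every `a`,
`D(a) = lim_i (a · x_i - x_i · a)` in norm. -/
def IsApproxInner (D : A →L[ℂ] StrongDual ℂ A) : Prop :=
  ∃ (ι : Type u) (_ : Preorder ι) (_ : IsDirectedOrder ι) (_ : Nonempty ι)
    (x : ι → StrongDual ℂ A),
    ∀ a : A, Tendsto (fun i => dualLeft a (x i) - dualRight (x i) a) atTop (𝓝 (D a))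

variable (A) in
/-- Every bounded derivation from `A` to its dual is approximately inner. -/
def ApproxWeaklyAmenable : Prop :=
  ∀ D : A →L[ℂ] StrongDual ℂ A, IsDualDerivation D → IsApproxInner D

end Derivations

section Arens

variable {A : Type u} [NonUnitalNormedRing A] [NormedSpace ℂ A] [IsScalarTower ℂ A A]
  [SMulCommClass ℂ A A]

/-- The map `a ↦ φ · a` from `A` to its dual. -/
def dualRightL (φ : StrongDual ℂ A) : A →L[ℂ] StrongDual ℂ A :=
  (ContinuousLinearMap.compL ℂ A A ℂ φ).comp (ContinuousLinearMap.mul ℂ A)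

@[simp] lemma dualRightL_apply (φ : StrongDual ℂ A) (a : A) :
    dualRightL φ a = dualRight φ a := rfl

lemma norm_dualRightL_le (φ : StrongDual ℂ A) : ‖dualRightL φ‖ ≤ ‖φ‖ :=
  ContinuousLinearMap.opNorm_le_bound₂ _ (norm_nonneg _) fun a c => by
    calc ‖φ (a * c)‖ ≤ ‖φ‖ * ‖a * c‖ := φ.le_opNorm _
      _ ≤ ‖φ‖ * (‖a‖ * ‖c‖) := by gcongr; exact norm_mul_le _ _
      _ = ‖φ‖ * ‖a‖ * ‖c‖ := by ring

/-- The action of the second dual on the dual: `⟨n · φ, a⟩ = ⟨n, φ · a⟩`. -/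
def bidualAct (n : StrongDual ℂ (StrongDual ℂ A)) : StrongDual ℂ A →L[ℂ] StrongDual ℂ A :=
  LinearMap.mkContinuous
    { toFun := fun φ => n.comp (dualRightL φ)
      map_add' := fun φ ψ => by
        ext a
        have : dualRight (φ + ψ) a = dualRight φ a + dualRight ψ a := rfl
        simp [this]
      map_smul' := fun c φ => by
        ext a
        have : dualRight (c • φ) a = c • dualRight φ a := rfl
        simp [this] } ‖n‖
    fun φ => (n.opNorm_comp_le _).trans (by gcongr; exact norm_dualRightL_le φ)

@[simp] lemma bidualAct_apply (n : StrongDual ℂ (StrongDual ℂ A)) (φ : StrongDual ℂ A) (a : A) :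
    bidualAct n φ a = n (dualRight φ a) := rfl

lemma norm_bidualAct_le (n : StrongDual ℂ (StrongDual ℂ A)) : ‖bidualAct n‖ ≤ ‖n‖ :=
  LinearMap.mkContinuous_norm_le _ (norm_nonneg n) _

variable (A) in
/-- The second dual of `A`, as a Banach algebra under the first Arens product. -/
def ArensBidual : Type u := StrongDual ℂ (StrongDual ℂ A)

instance : NormedAddCommGroup (ArensBidual A) :=
  inferInstanceAs (NormedAddCommGroup (StrongDual ℂ (StrongDual ℂ A)))

instance : NormedSpace ℂ (ArensBidual A) :=
  inferInstanceAs (NormedSpace ℂ (StrongDual ℂ (StrongDual ℂ A)))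

instance : CompleteSpace (ArensBidual A) :=
  inferInstanceAs (CompleteSpace (StrongDual ℂ (StrongDual ℂ A)))

/-- The elements of `ArensBidual A` are the bounded functionals on the dual of `A`. -/
def ArensBidual.toDual : ArensBidual A ≃ₗᵢ[ℂ] StrongDual ℂ (StrongDual ℂ A) :=
  LinearIsometryEquiv.refl ℂ (StrongDual ℂ (StrongDual ℂ A))

/-- The first Arens product: `⟨m □ n, φ⟩ = ⟨m, n · φ⟩`. -/
instance : Mul (ArensBidual A) :=
  ⟨fun m n => ArensBidual.toDual.symm
    ((ArensBidual.toDual m).comp (bidualAct (ArensBidual.toDual n)))⟩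

@[simp] lemma ArensBidual.toDual_mul (m n : ArensBidual A) (φ : StrongDual ℂ A) :
    ArensBidual.toDual (m * n) φ = ArensBidual.toDual m (bidualAct (ArensBidual.toDual n) φ) :=
  rfl

lemma ArensBidual.ext' {m n : ArensBidual A}
    (h : ∀ φ, ArensBidual.toDual m φ = ArensBidual.toDual n φ) : m = n :=
  ArensBidual.toDual.injective (ContinuousLinearMap.ext h)

instance : NonUnitalNormedRing (ArensBidual A) :=
  { (inferInstance : NormedAddCommGroup (ArensBidual A)),
    (inferInstance : Mul (ArensBidual A)) with
    left_distrib := fun m n k => ArensBidual.ext' fun φ => by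
      have : bidualAct (ArensBidual.toDual n + ArensBidual.toDual k) φ
        = bidualAct (ArensBidual.toDual n) φ + bidualAct (ArensBidual.toDual k) φ := rfl
      simp [this]
    right_distrib := fun m n k => ArensBidual.ext' fun φ => by simp
    zero_mul := fun m => ArensBidual.ext' fun φ => rfl
    mul_zero := fun m => ArensBidual.ext' fun φ => map_zero (ArensBidual.toDual m)
    mul_assoc := fun m n k => ArensBidual.ext' fun φ => by
      simp only [ArensBidual.toDual_mul]
      congr 1
      ext a
      simp only [bidualAct_apply, ArensBidual.toDual_mul]
      congr 1
      ext b
      simp only [bidualAct_apply, dualRight_apply]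
      congr 1
      ext c
      simp [mul_assoc]
    norm_mul_le := fun m n => by
      calc ‖m * n‖ ≤ ‖ArensBidual.toDual m‖ * ‖bidualAct (ArensBidual.toDual n)‖ :=
            ContinuousLinearMap.opNorm_comp_le _ _
        _ ≤ ‖m‖ * ‖n‖ := by
            gcongr
            · exact le_of_eq (ArensBidual.toDual.norm_map m)
            · exact (norm_bidualAct_le _).trans (le_of_eq (ArensBidual.toDual.norm_map n)) }

instance : IsScalarTower ℂ (ArensBidual A) (ArensBidual A) :=
  ⟨fun c m n => ArensBidual.ext' fun φ => by simp⟩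

instance : SMulCommClass ℂ (ArensBidual A) (ArensBidual A) :=
  ⟨fun c m n => ArensBidual.ext' fun φ => by
    have : bidualAct (c • ArensBidual.toDual n) φ
      = c • bidualAct (ArensBidual.toDual n) φ := rfl
    simp [this]⟩

end Arens

section ComplexMeasures

variable {X : Type u} [MeasurableSpace X]

instance isFiniteMeasure_variation_complex (μ : ComplexMeasure X) :
    IsFiniteMeasure μ.variation := by
  have h : μ.variation ≤ (ComplexMeasure.re μ).totalVariation
      + (ComplexMeasure.im μ).totalVariation := by
    refine VectorMeasure.variation_le_of_forall_enorm_le fun E _ => ?_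
    have h1 : ‖μ E‖ₑ ≤ ‖(μ E).re‖ₑ + ‖(μ E).im‖ₑ := by
      have h2 : μ E = ((μ E).re : ℂ) + ((μ E).im : ℂ) * Complex.I := (Complex.re_add_im _).symm
      calc ‖μ E‖ₑ = ‖((μ E).re : ℂ) + ((μ E).im : ℂ) * Complex.I‖ₑ := by rw [← h2]
        _ ≤ ‖((μ E).re : ℂ)‖ₑ + ‖((μ E).im : ℂ) * Complex.I‖ₑ := enorm_add_le _ _
        _ = ‖(μ E).re‖ₑ + ‖(μ E).im‖ₑ := by
            simp [← ofReal_norm]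
    refine h1.trans (add_le_add ?_ ?_)
    · exact SignedMeasure.enorm_le_totalVariation (ComplexMeasure.re μ) E
    · exact SignedMeasure.enorm_le_totalVariation (ComplexMeasure.im μ) E
  exact isFiniteMeasure_of_le _ h

/-- The integral `∫ f dμ` of a complex function against a complex measure. -/
def cIntegral (μ : ComplexMeasure X) (f : X → ℂ) : ℂ :=
  μ.integral f (ContinuousLinearMap.mul ℝ ℂ)

lemma norm_cIntegral_le (μ : ComplexMeasure X) (f : X → ℂ) :
    ‖cIntegral μ f‖ ≤ ∫ x, ‖f x‖ ∂μ.variation := by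
  refine VectorMeasure.norm_integral_le_integral_norm.trans ?_
  refine mul_le_of_le_one_left (integral_nonneg fun x => norm_nonneg _) ?_
  exact ContinuousLinearMap.opNorm_mul_le ℝ ℂ

lemma cIntegral_add (μ : ComplexMeasure X) {f g : X → ℂ} (hf : Integrable f μ.variation)
    (hg : Integrable g μ.variation) :
    cIntegral μ (fun x => f x + g x) = cIntegral μ f + cIntegral μ g :=
  VectorMeasure.integral_fun_add hf hg

lemma cIntegral_sub (μ : ComplexMeasure X) {f g : X → ℂ} (hf : Integrable f μ.variation)
    (hg : Integrable g μ.variation) :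
    cIntegral μ (fun x => f x - g x) = cIntegral μ f - cIntegral μ g :=
  VectorMeasure.integral_fun_sub hf hg

lemma cIntegral_const_mul (μ : ComplexMeasure X) (c : ℂ) {f : X → ℂ}
    (hf : Integrable f μ.variation) :
    cIntegral μ (fun x => c * f x) = c * cIntegral μ f := by
  have h1 := VectorMeasure.integral_continuousLinearMap_comp (μ := μ)
    (B := ContinuousLinearMap.mul ℝ ℂ) (C := ContinuousLinearMap.mul ℝ ℂ c) hf
  have h2 := VectorMeasure.continuousLinearMap_apply_integral (μ := μ)
    (B := ContinuousLinearMap.mul ℝ ℂ) (C := ContinuousLinearMap.mul ℝ ℂ c) hf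
  refine h1.trans (Eq.trans ?_ h2.symm)
  congr 1
  ext a b
  exact mul_assoc c a b

lemma cIntegral_add_measure (μ ν : ComplexMeasure X) {f : X → ℂ}
    (hμ : Integrable f μ.variation) (hν : Integrable f ν.variation) :
    cIntegral (μ + ν) f = cIntegral μ f + cIntegral ν f :=
  VectorMeasure.integral_add_vectorMeasure hμ hν

lemma cIntegral_smul_measure (c : ℂ) (μ : ComplexMeasure X) {f : X → ℂ}
    (hf : Integrable f μ.variation) :
    cIntegral (c • μ) f = c * cIntegral μ f := by
  have h2 := VectorMeasure.continuousLinearMap_apply_integral (μ := μ)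
    (B := ContinuousLinearMap.mul ℝ ℂ) (C := ContinuousLinearMap.mul ℝ ℂ c) hf
  refine Eq.trans ?_ h2.symm
  have hT : (c • μ).transpose (ContinuousLinearMap.mul ℝ ℂ) = μ.transpose
      ((ContinuousLinearMap.compL ℝ ℂ ℂ ℂ (ContinuousLinearMap.mul ℝ ℂ c)) ∘L
        ContinuousLinearMap.mul ℝ ℂ) := by
    ext s hs z
    exact mul_left_comm z c (μ s)
  have hdom := dominatedFinMeasAdditive_cbmApplyMeasure (c • μ) (ContinuousLinearMap.mul ℝ ℂ)
  have key : cIntegral (c • μ) f = setToFun (c • μ).variation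
      ((c • μ).transpose (ContinuousLinearMap.mul ℝ ℂ)) hdom f := rfl
  rw [key, VectorMeasure.integral_eq_setToFun]
  symm
  have hle : (c • μ).variation ≤ (‖c‖₊ : ℝ≥0∞) • μ.variation := by
    rw [VectorMeasure.variation_smul]; exact le_rfl
  simp only [← hT]
  exact setToFun_congr_measure_of_integrable _ ENNReal.coe_ne_top hle _ _ f hf

lemma cIntegral_indicator (μ : ComplexMeasure X) {s : Set X} (hs : MeasurableSet s) (c : ℂ) :
    cIntegral μ (s.indicator fun _ => c) = c * μ s :=
  VectorMeasure.integral_indicator_const _ hs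

end ComplexMeasures

section RegularMeasures

variable {X : Type u} [TopologicalSpace X] [T2Space X] [LocallyCompactSpace X]
  [MeasurableSpace X] [BorelSpace X]

lemma regular_of_le_regular {μ ν : Measure X} [IsFiniteMeasure μ] [μ.Regular] (h : ν ≤ μ) :
    ν.Regular := by
  have hfin : IsFiniteMeasure ν := isFiniteMeasure_of_le μ h
  have hin : ν.InnerRegularCompactLTTop := by
    refine ⟨fun A hA r hr => ?_⟩
    obtain ⟨K, hKA, hK, hlt⟩ := hA.1.exists_isCompact_sdiff_lt (μ := μ) (measure_ne_top μ A)
      (ε := ν A - r) (tsub_pos_of_lt hr).ne'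
    refine ⟨K, hKA, hK, ?_⟩
    by_contra hcon
    have h1 : ν A ≤ ν K + ν (A \ K) := by
      calc ν A ≤ ν (K ∪ A \ K) := measure_mono (by simp)
        _ ≤ ν K + ν (A \ K) := measure_union_le _ _
    have h2 : ν (A \ K) < ν A - r := (h _).trans_lt hlt
    have h3 : ν A < r + (ν A - r) := by
      calc ν A ≤ ν K + ν (A \ K) := h1
        _ ≤ r + ν (A \ K) := by gcongr; exact not_lt.1 hcon
        _ < r + (ν A - r) := ENNReal.add_lt_add_left (ne_top_of_lt hr) h2
    rw [add_tsub_cancel_of_le hr.le] at h3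
    exact lt_irrefl _ h3
  infer_instance

lemma regular_add {μ ν : Measure X} [IsFiniteMeasure μ] [IsFiniteMeasure ν] [μ.Regular]
    [ν.Regular] : (μ + ν).Regular := by
  infer_instance

/-- A compactly supported continuous approximation in `L¹` of a regular measure. -/
lemma exists_compactSupport_approx (μ : Measure X) [μ.Regular] {f : X → ℂ} (hf : Integrable f μ)
    {ε : ℝ≥0∞} (hε : ε ≠ 0) :
    ∃ g : X → ℂ, eLpNorm (f - g) 1 μ ≤ ε ∧ Continuous g ∧ HasCompactSupport g := by
  refine MemLp.induction_dense ENNReal.one_ne_top _ ?_ ?_ ?_ (memLp_one_iff_integrable.2 hf) hε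
  · intro c t ht htμ ε hε
    obtain ⟨η, ηpos, hη⟩ := exists_eLpNorm_indicator_le (μ := μ) ENNReal.one_ne_top c hε
    have hη2 : (η : ℝ≥0∞) / 2 ≠ 0 := by simp [ηpos.ne']
    obtain ⟨K, hKt, hK, hμK⟩ := ht.exists_isCompact_sdiff_lt (μ := μ) htμ.ne hη2
    obtain ⟨U, htU, hU, hUtop, hμU⟩ := ht.exists_isOpen_sdiff_lt (μ := μ) htμ.ne hη2
    obtain ⟨φ, hφ1, hφ0, hφc, hφr⟩ := exists_continuous_one_zero_of_isCompact hK hU.isClosed_compl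
      (Set.disjoint_compl_right_iff_subset.2 (hKt.trans htU))
    refine ⟨fun x => (φ x : ℂ) * c, ?_, by fun_prop, ?_⟩
    · have hS : μ (U \ K) ≤ η := by
        calc μ (U \ K) ≤ μ (U \ t ∪ t \ K) := measure_mono (by
              intro x hx; by_cases h : x ∈ t
              · exact Or.inr ⟨h, hx.2⟩
              · exact Or.inl ⟨hx.1, h⟩)
          _ ≤ μ (U \ t) + μ (t \ K) := measure_union_le _ _
          _ ≤ η / 2 + η / 2 := add_le_add hμU.le hμK.le
          _ = η := ENNReal.add_halves _
      refine (eLpNorm_mono fun x => ?_).trans (hη (U \ K) hS)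
      by_cases hxK : x ∈ K
      · have h1 : φ x = 1 := hφ1 hxK
        have h2 : x ∈ t := hKt hxK
        simp [h1, h2]
      · by_cases hxU : x ∈ U
        · rw [Set.indicator_of_mem (show x ∈ U \ K from ⟨hxU, hxK⟩)]
          have h01 := hφr x
          by_cases hxt : x ∈ t
          · have : (φ x : ℂ) * c - c = ((φ x - 1 : ℝ) : ℂ) * c := by push_cast; ring
            simp only [Pi.sub_apply, Set.indicator_of_mem hxt, this, norm_mul, Complex.norm_real]
            refine mul_le_of_le_one_left (norm_nonneg _) ?_
            rw [Real.norm_eq_abs, abs_le]; constructor <;> linarith [h01.1, h01.2]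
          · simp only [Pi.sub_apply, Set.indicator_of_notMem hxt, sub_zero, norm_mul,
              Complex.norm_real]
            refine mul_le_of_le_one_left (norm_nonneg _) ?_
            rw [Real.norm_eq_abs, abs_le]; constructor <;> linarith [h01.1, h01.2]
        · have h0 : φ x = 0 := hφ0 hxU
          have hxt : x ∉ t := fun h => hxU (htU h)
          simp [h0, hxt]
    · exact HasCompactSupport.mul_right (hφc.comp_left Complex.ofReal_zero)
  · rintro f g ⟨hf, hf'⟩ ⟨hg, hg'⟩
    exact ⟨hf.add hg, hf'.add hg'⟩
  · rintro f ⟨hf, hf'⟩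
    exact (hf.stronglyMeasurable_of_hasCompactSupport hf').aestronglyMeasurable

lemma c0_bound (f : C₀(X, ℂ)) (x : X) : ‖f x‖ ≤ ‖f‖ := f.toBCF.norm_coe_le_norm x

lemma c0_norm_le (f : C₀(X, ℂ)) {C : ℝ} (hC : 0 ≤ C) (h : ∀ x, ‖f x‖ ≤ C) : ‖f‖ ≤ C :=
  (BoundedContinuousFunction.norm_le hC).2 h

lemma c0_stronglyMeasurable (f : C₀(X, ℂ)) : StronglyMeasurable f :=
  (map_continuous f).measurable.stronglyMeasurable

lemma c0_integrable (μ : Measure X) [IsFiniteMeasure μ] (f : C₀(X, ℂ)) : Integrable f μ :=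
  Integrable.mono' (integrable_const ‖f‖) (c0_stronglyMeasurable f).aestronglyMeasurable
    (Eventually.of_forall (c0_bound f))

/-- A continuous compactly supported function, as an element of `C₀(X)`. -/
def c0OfCompactSupport (f : X → ℂ) (hf : Continuous f) (hc : HasCompactSupport f) : C₀(X, ℂ) where
  toFun := f
  continuous_toFun := hf
  zero_at_infty' := hc.is_zero_at_infty

lemma c0_exists_compactSupport (f : C₀(X, ℂ)) {ε : ℝ} (hε : 0 < ε) :
    ∃ g : C₀(X, ℂ), HasCompactSupport g ∧ ‖f - g‖ ≤ ε ∧ ∀ x, ‖g x‖ ≤ ‖f x‖ := by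
  have h1 : ∀ᶠ x in cocompact X, ‖f x‖ < ε := by
    have := (f.zero_at_infty').norm
    rw [norm_zero] at this
    exact this.eventually_lt_const hε
  obtain ⟨K, hK, hKs⟩ := mem_cocompact.1 h1
  obtain ⟨φ, hφ1, -, hφc, hφr⟩ := exists_continuous_one_zero_of_isCompact hK isClosed_empty
    (Set.disjoint_empty K)
  have hc : HasCompactSupport fun x => (φ x : ℂ) * f x :=
    HasCompactSupport.mul_right (hφc.comp_left Complex.ofReal_zero)
  refine ⟨c0OfCompactSupport (fun x => (φ x : ℂ) * f x)
    (by have := map_continuous f; fun_prop) hc, hc, ?_, ?_⟩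
  · refine c0_norm_le _ hε.le fun x => ?_
    change ‖f x - (φ x : ℂ) * f x‖ ≤ ε
    by_cases hx : x ∈ K
    · have : φ x = 1 := hφ1 hx
      simp [this, hε.le]
    · have h2 : ‖f x‖ < ε := hKs hx
      have h3 : f x - (φ x : ℂ) * f x = ((1 - φ x : ℝ) : ℂ) * f x := by push_cast; ring
      rw [h3, norm_mul, Complex.norm_real, Real.norm_eq_abs]
      have h01 := hφr x
      have : |1 - φ x| ≤ 1 := by rw [abs_le]; constructor <;> linarith [h01.1, h01.2]
      calc _ ≤ 1 * ‖f x‖ := by gcongr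
        _ ≤ ε := by linarith
  · intro x
    change ‖(φ x : ℂ) * f x‖ ≤ ‖f x‖
    rw [norm_mul, Complex.norm_real, Real.norm_eq_abs]
    have h01 := hφr x
    refine mul_le_of_le_one_left (norm_nonneg _) ?_
    rw [abs_le]; constructor <;> linarith [h01.1, h01.2]

variable (X) in
/-- The regular complex Borel measures: those whose total variation is a regular measure. -/
def regularComplexMeasures : Submodule ℂ (ComplexMeasure X) where
  carrier := {μ | μ.variation.Regular}
  zero_mem' := by
    simp only [Set.mem_ofPred_eq, VectorMeasure.variation_zero]
    infer_instance
  add_mem' := by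
    intro μ ν hμ hν
    have h1 : μ.variation.Regular := hμ
    have h2 : ν.variation.Regular := hν
    have h3 : (μ.variation + ν.variation).Regular := regular_add
    exact regular_of_le_regular VectorMeasure.variation_add_le
  smul_mem' := by
    intro c μ hμ
    have h1 : μ.variation.Regular := hμ
    simp only [Set.mem_ofPred_eq, VectorMeasure.variation_smul]
    infer_instance

variable (X) in
/-- The space `M(X)` of regular complex Borel measures on `X`, with the total variation norm. -/
def RegMeasure : Type u := regularComplexMeasures X

instance : AddCommGroup (RegMeasure X) := inferInstanceAs (AddCommGroup (regularComplexMeasures X))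

instance : Module ℂ (RegMeasure X) := inferInstanceAs (Module ℂ (regularComplexMeasures X))

lemma RegMeasure.coe_add (μ ν : RegMeasure X) : (μ + ν).1 = μ.1 + ν.1 := rfl

lemma RegMeasure.coe_smul (c : ℂ) (μ : RegMeasure X) : (c • μ).1 = c • μ.1 := rfl

instance (μ : RegMeasure X) : μ.1.variation.Regular := μ.2

/-- The total variation norm `‖μ‖ = |μ|(X)`. -/
instance : Norm (RegMeasure X) := ⟨fun μ => μ.1.variation.real Set.univ⟩

lemma RegMeasure.norm_def (μ : RegMeasure X) : ‖μ‖ = μ.1.variation.real Set.univ := rfl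

lemma RegMeasure.core : NormedSpace.Core ℂ (RegMeasure X) where
  norm_nonneg μ := measureReal_nonneg
  norm_smul c μ := by
    rw [RegMeasure.norm_def, RegMeasure.norm_def, RegMeasure.coe_smul, VectorMeasure.variation_smul]
    simp [measureReal_def]
  norm_triangle μ ν := by
    have h : (μ.1 + ν.1).variation ≤ μ.1.variation + ν.1.variation :=
      VectorMeasure.variation_add_le
    have h2 := h Set.univ
    rw [Measure.add_apply] at h2
    have h3 := ENNReal.toReal_mono (by finiteness) h2
    rw [ENNReal.toReal_add (by finiteness) (by finiteness)] at h3
    exact h3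
  norm_eq_zero_iff μ := by
    rw [RegMeasure.norm_def, measureReal_eq_zero_iff, Measure.measure_univ_eq_zero,
      VectorMeasure.variation_eq_zero]
    exact Submodule.coe_eq_zero

instance : NormedAddCommGroup (RegMeasure X) := NormedAddCommGroup.ofCore RegMeasure.core

instance : NormedSpace ℂ (RegMeasure X) := NormedSpace.ofCore RegMeasure.core

lemma RegMeasure.norm_eq (μ : RegMeasure X) : ‖μ‖ = μ.1.variation.real Set.univ := rfl

lemma RegMeasure.norm_cIntegral_le (μ : RegMeasure X) (f : C₀(X, ℂ)) :
    ‖cIntegral μ.1 f‖ ≤ ‖μ‖ * ‖f‖ := by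
  refine (_root_.norm_cIntegral_le _ _).trans ?_
  calc ∫ x, ‖f x‖ ∂μ.1.variation ≤ ∫ x, ‖f‖ ∂μ.1.variation :=
        integral_mono (c0_integrable _ f).norm (integrable_const _) (c0_bound f)
    _ = ‖μ‖ * ‖f‖ := by simp [RegMeasure.norm_eq]

/-- Integration against `μ`, as a bounded functional on `C₀(X)`. -/
def RegMeasure.toDual (μ : RegMeasure X) : StrongDual ℂ C₀(X, ℂ) :=
  LinearMap.mkContinuous
    { toFun := fun f => cIntegral μ.1 f
      map_add' := fun f g => cIntegral_add μ.1 (c0_integrable _ f) (c0_integrable _ g)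
      map_smul' := fun c f => cIntegral_const_mul μ.1 c (c0_integrable _ f) } ‖μ‖
    (RegMeasure.norm_cIntegral_le μ)

@[simp] lemma RegMeasure.toDual_apply (μ : RegMeasure X) (f : C₀(X, ℂ)) :
    μ.toDual f = cIntegral μ.1 f := rfl

lemma exists_truncation {f : X → ℂ} (hfc : Continuous f) (hfs : HasCompactSupport f) :
    ∃ k : X → ℂ, Continuous k ∧ HasCompactSupport k ∧ (∀ x, ‖k x‖ ≤ 1) ∧
      ∀ x, ∀ z : ℂ, ‖z‖ ≤ 1 → ‖f x - k x‖ ≤ ‖z - f x‖ := by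
  let m : X → ℝ := fun x => (max 1 ‖f x‖)⁻¹
  let k : X → ℂ := fun x => m x • f x
  have hmax : ∀ x, 0 < max 1 ‖f x‖ := fun x => lt_max_of_lt_left one_pos
  have hmc : Continuous m :=
    (continuous_const.max hfc.norm).inv₀ fun x => (hmax x).ne'
  have hkc : Continuous k := hmc.smul hfc
  have hks : HasCompactSupport k := HasCompactSupport.smul_left (f := m) hfs
  have hkn : ∀ x, ‖k x‖ ≤ 1 := by
    intro x
    simp only [k, m, norm_smul, norm_inv, Real.norm_eq_abs, abs_of_pos (hmax x)]
    rw [inv_mul_le_iff₀ (hmax x), mul_one]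
    exact le_max_right _ _
  have hkf : ∀ x, ∀ z : ℂ, ‖z‖ ≤ 1 → ‖f x - k x‖ ≤ ‖z - f x‖ := by
    intro x z hz
    have h1 : f x - k x = ((1 - (max 1 ‖f x‖)⁻¹ : ℝ)) • f x := by
      simp only [k, m, sub_smul, one_smul]
    rw [h1, norm_smul]
    rcases le_total ‖f x‖ 1 with h | h
    · simp [max_eq_left h]
    · rw [max_eq_right h]
      have h0 : 0 < ‖f x‖ := one_pos.trans_le h
      have h2 : (‖f x‖)⁻¹ ≤ 1 := inv_le_one_of_one_le₀ h
      rw [Real.norm_eq_abs, abs_of_nonneg (by linarith), sub_mul, inv_mul_cancel₀ h0.ne', one_mul]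
      have h3 := norm_sub_norm_le (f x) z
      rw [norm_sub_rev] at h3
      linarith
  exact ⟨k, hkc, hks, hkn, hkf⟩

lemma RegMeasure.norm_cIntegral_le_of_bound (μ : RegMeasure X) {g : X → ℂ}
    (hg : Integrable g μ.1.variation) (hg1 : ∀ x, ‖g x‖ ≤ 1) :
    ‖cIntegral μ.1 g‖ ≤ ‖μ.toDual‖ := by
  refine le_of_forall_pos_le_add fun ε hε => ?_
  obtain ⟨f, hfg, hfc, hfs⟩ := exists_compactSupport_approx μ.1.variation hg
    (ε := ENNReal.ofReal (ε / 2)) (by simp [hε])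
  have hfi : Integrable f μ.1.variation := hfc.integrable_of_hasCompactSupport hfs
  have hint : ∫ x, ‖g x - f x‖ ∂μ.1.variation ≤ ε / 2 := by
    have h1 : eLpNorm (g - f) 1 μ.1.variation = ENNReal.ofReal (∫ x, ‖g x - f x‖ ∂μ.1.variation) :=
      by
        rw [eLpNorm_one_eq_lintegral_enorm]
        exact (ofReal_integral_norm_eq_lintegral_enorm (hg.sub hfi)).symm
    rw [h1] at hfg
    exact (ENNReal.ofReal_le_ofReal_iff (by positivity)).1 hfg
  obtain ⟨k, hkc, hks, hkn, hkf0⟩ := exists_truncation hfc hfs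
  have hkf : ∀ x, ‖f x - k x‖ ≤ ‖g x - f x‖ := fun x => hkf0 x (g x) (hg1 x)
  let k0 := c0OfCompactSupport k hkc hks
  have hki : Integrable k μ.1.variation := hkc.integrable_of_hasCompactSupport hks
  have hgk : ‖cIntegral μ.1 fun x => g x - k x‖ ≤ ε := by
    refine (_root_.norm_cIntegral_le _ _).trans ?_
    calc ∫ x, ‖g x - k x‖ ∂μ.1.variation ≤ ∫ x, 2 * ‖g x - f x‖ ∂μ.1.variation := by
          refine integral_mono (hg.sub hki).norm ((hg.sub hfi).norm.const_mul 2) fun x => ?_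
          have : g x - k x = (g x - f x) + (f x - k x) := by ring
          calc ‖g x - k x‖ ≤ ‖g x - f x‖ + ‖f x - k x‖ := by rw [this]; exact norm_add_le _ _
            _ ≤ 2 * ‖g x - f x‖ := by linarith [hkf x]
      _ = 2 * ∫ x, ‖g x - f x‖ ∂μ.1.variation := integral_const_mul _ _
      _ ≤ ε := by linarith
  rw [cIntegral_sub _ hg hki] at hgk
  have hk1 : ‖cIntegral μ.1 k‖ ≤ ‖μ.toDual‖ := by
    have h1 : ‖k0‖ ≤ 1 := c0_norm_le _ zero_le_one hkn
    calc ‖cIntegral μ.1 k‖ = ‖μ.toDual k0‖ := rfl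
      _ ≤ ‖μ.toDual‖ * ‖k0‖ := μ.toDual.le_opNorm _
      _ ≤ ‖μ.toDual‖ := mul_le_of_le_one_right (norm_nonneg μ.toDual) h1
  calc ‖cIntegral μ.1 g‖ = ‖cIntegral μ.1 k + (cIntegral μ.1 g - cIntegral μ.1 k)‖ := by
        congr 1; ring
    _ ≤ ‖cIntegral μ.1 k‖ + ‖cIntegral μ.1 g - cIntegral μ.1 k‖ := norm_add_le _ _
    _ ≤ ‖μ.toDual‖ + ε := add_le_add hk1 hgk

lemma RegMeasure.norm_toDual (μ : RegMeasure X) : ‖μ.toDual‖ = ‖μ‖ := by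
  classical
  refine le_antisymm (LinearMap.mkContinuous_norm_le _ (norm_nonneg μ) _) ?_
  refine le_of_forall_pos_le_add fun ε hε => ?_
  obtain ⟨P, -, hPd, hPm, hP⟩ := μ.1.exists_variation_le_add' MeasurableSet.univ
    (ε := ENNReal.ofReal ε) (by simpa using hε) (measure_ne_top _ _)
  have hc : ∀ p : Set X, ∃ c : ℂ, ‖c‖ ≤ 1 ∧ c * μ.1 p = ‖μ.1 p‖ := by
    intro p
    by_cases h : μ.1 p = 0
    · exact ⟨0, by simp, by simp [h]⟩
    · have h' : (‖μ.1 p‖ : ℂ) ≠ 0 := by simpa using h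
      refine ⟨(starRingEnd ℂ) (μ.1 p) / ‖μ.1 p‖, ?_, ?_⟩
      · rw [norm_div, RCLike.norm_conj, Complex.norm_real, norm_norm, div_self (by simpa using h)]
      · rw [div_mul_eq_mul_div, div_eq_iff h', mul_comm, Complex.mul_conj, Complex.normSq_eq_norm_sq]
        push_cast; ring
  choose c hc1 hc2 using hc
  let g : X → ℂ := fun x => ∑ p ∈ P, p.indicator (fun _ => c p) x
  have hgi : ∀ p ∈ P, Integrable (p.indicator fun _ => c p) μ.1.variation := fun p hp =>
    (integrable_const _).indicator (hPm p hp)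
  have hg : Integrable g μ.1.variation := integrable_finsetSum _ hgi
  have hg1 : ∀ x, ‖g x‖ ≤ 1 := by
    intro x
    by_cases hx : ∃ p ∈ P, x ∈ p
    · obtain ⟨p, hp, hxp⟩ := hx
      have : g x = c p := by
        simp only [g]
        rw [Finset.sum_eq_single_of_mem p hp, Set.indicator_of_mem hxp]
        intro q hq hqp
        refine Set.indicator_of_notMem (fun hxq => ?_) _
        exact Set.disjoint_left.1 (hPd hq hp hqp) hxq hxp
      rw [this]; exact hc1 p
    · push Not at hx
      have : g x = 0 := Finset.sum_eq_zero fun p hp => Set.indicator_of_notMem (hx p hp) _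
      simp [this]
  have hval : cIntegral μ.1 g = ((∑ p ∈ P, ‖μ.1 p‖ : ℝ) : ℂ) := by
    have h1 : cIntegral μ.1 g = ∑ p ∈ P, cIntegral μ.1 (p.indicator fun _ => c p) :=
      VectorMeasure.integral_finsetSum P hgi
    rw [h1]
    push_cast
    refine Finset.sum_congr rfl fun p hp => ?_
    rw [cIntegral_indicator _ (hPm p hp), hc2]
  have h2 := μ.norm_cIntegral_le_of_bound hg hg1
  have hnn : 0 ≤ ∑ p ∈ P, ‖μ.1 p‖ := Finset.sum_nonneg fun p _ => norm_nonneg _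
  rw [hval, Complex.norm_real, Real.norm_eq_abs, abs_of_nonneg hnn] at h2
  have h3 : ‖μ‖ ≤ ∑ p ∈ P, ‖μ.1 p‖ + ε := by
    have h4 : ∑ p ∈ P, ‖μ.1 p‖ₑ + ENNReal.ofReal ε
        = ENNReal.ofReal (∑ p ∈ P, ‖μ.1 p‖ + ε) := by
      rw [ENNReal.ofReal_add hnn hε.le, ENNReal.ofReal_sum_of_nonneg fun p _ => norm_nonneg _]
      simp
    rw [h4] at hP
    rw [RegMeasure.norm_eq, measureReal_def]
    exact ENNReal.toReal_le_of_le_ofReal (by positivity) hP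
  linarith

section Surjective

variable (Λ : StrongDual ℂ C₀(X, ℂ))

open CompactlySupported CompactlySupportedContinuousMap

/-- The functional `f ↦ sup {|Λ g| : |g| ≤ f}` on nonnegative functions. -/
def absFunctional (f : C_c(X, ℝ≥0)) : ℝ≥0 :=
  ⨆ g : {g : C₀(X, ℂ) // ∀ x, ‖g x‖₊ ≤ f x}, ‖Λ g.1‖₊

lemma absFunctional_le {f : C_c(X, ℝ≥0)} {C : ℝ≥0}
    (h : ∀ g : C₀(X, ℂ), (∀ x, ‖g x‖₊ ≤ f x) → ‖Λ g‖₊ ≤ C) : absFunctional Λ f ≤ C := by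
  have : Nonempty {g : C₀(X, ℂ) // ∀ x, ‖g x‖₊ ≤ f x} := ⟨⟨0, fun x => by simp⟩⟩
  exact ciSup_le fun g => h g.1 g.2

lemma absFunctional_bdd (f : C_c(X, ℝ≥0)) :
    BddAbove (Set.range fun g : {g : C₀(X, ℂ) // ∀ x, ‖g x‖₊ ≤ f x} => ‖Λ g.1‖₊) := by
  obtain ⟨C, hC⟩ := (f.hasCompactSupport.comp_left (g := fun y : ℝ≥0 => (y : ℝ))
    rfl).exists_bound_of_continuous (NNReal.continuous_coe.comp (map_continuous f))
  refine ⟨‖Λ‖₊ * C.toNNReal, ?_⟩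
  rintro _ ⟨g, rfl⟩
  have h1 : ‖g.1‖ ≤ C.toNNReal := by
    refine c0_norm_le _ (NNReal.coe_nonneg _) fun x => ?_
    have h2 := hC x
    simp only [Function.comp_apply, Real.norm_eq_abs, NNReal.abs_eq] at h2
    calc ‖g.1 x‖ ≤ f x := g.2 x
      _ ≤ C := h2
      _ ≤ C.toNNReal := Real.le_coe_toNNReal C
  change ‖Λ g.1‖₊ ≤ _
  refine (Λ.le_opNNNorm _).trans ?_
  gcongr
  exact h1

lemma le_absFunctional {f : C_c(X, ℝ≥0)} (g : C₀(X, ℂ)) (h : ∀ x, ‖g x‖₊ ≤ f x) :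
    ‖Λ g‖₊ ≤ absFunctional Λ f :=
  le_ciSup (absFunctional_bdd Λ f) ⟨g, h⟩

lemma exists_unimodular (z : ℂ) : ∃ c : ℂ, ‖c‖₊ ≤ 1 ∧ c * z = (‖z‖ : ℂ) := by
  by_cases h : z = 0
  · exact ⟨0, by simp, by simp [h]⟩
  · have h' : (‖z‖ : ℂ) ≠ 0 := by simpa using h
    refine ⟨(starRingEnd ℂ) z / ‖z‖, ?_, ?_⟩
    · rw [← NNReal.coe_le_coe, coe_nnnorm, norm_div, RCLike.norm_conj, Complex.norm_real,
        norm_norm, div_self (by simpa using h), NNReal.coe_one]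
    · rw [div_mul_eq_mul_div, div_eq_iff h', mul_comm, Complex.mul_conj, Complex.normSq_eq_norm_sq]
      push_cast; ring

lemma absFunctional_add (f₁ f₂ : C_c(X, ℝ≥0)) :
    absFunctional Λ (f₁ + f₂) = absFunctional Λ f₁ + absFunctional Λ f₂ := by
  apply le_antisymm
  · refine absFunctional_le Λ fun g hg => ?_
    let r : C_c(X, ℝ≥0) → X → ℂ := fun f x =>
      (((f x : ℝ) / ((f₁ x : ℝ) + (f₂ x : ℝ)) : ℝ) : ℂ) * g x
    have hgn : ∀ x, ‖g x‖ ≤ (f₁ x : ℝ) + f₂ x := fun x => hg x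
    have hrg : ∀ f : C_c(X, ℝ≥0), (∀ x, f x ≤ f₁ x + f₂ x) → ∀ x, ‖r f x‖ ≤ ‖g x‖ := by
      intro f hf x
      simp only [r, norm_mul, Complex.norm_real]
      refine mul_le_of_le_one_left (norm_nonneg _) ?_
      rw [Real.norm_eq_abs, abs_of_nonneg (by positivity)]
      exact div_le_one_of_le₀ (by exact_mod_cast hf x) (by positivity)
    have hrf : ∀ f : C_c(X, ℝ≥0), ∀ x, ‖r f x‖₊ ≤ f x := by
      intro f x
      rw [← NNReal.coe_le_coe, coe_nnnorm]
      simp only [r, norm_mul, Complex.norm_real]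
      rw [Real.norm_eq_abs, abs_of_nonneg (by positivity)]
      rcases (add_nonneg (f₁ x).2 (f₂ x).2).eq_or_lt with h0 | h0
      · have : (f₁ x : ℝ) + f₂ x = 0 := h0.symm
        simp [this]
      · calc _ ≤ (f x : ℝ) / ((f₁ x : ℝ) + f₂ x) * ((f₁ x : ℝ) + f₂ x) := by
              gcongr; exact hgn x
          _ = f x := div_mul_cancel₀ _ h0.ne'
    have hcont : ∀ f : C_c(X, ℝ≥0), (∀ x, f x ≤ f₁ x + f₂ x) → Continuous (r f) := by
      intro f hf
      have c1 : Continuous fun x => (f₁ x : ℝ) := NNReal.continuous_coe.comp (map_continuous f₁)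
      have c2 : Continuous fun x => (f₂ x : ℝ) := NNReal.continuous_coe.comp (map_continuous f₂)
      have c3 : Continuous fun x => (f x : ℝ) := NNReal.continuous_coe.comp (map_continuous f)
      have cg : Continuous g := map_continuous g
      rw [continuous_iff_continuousAt]
      intro x
      by_cases h0 : (f₁ x : ℝ) + f₂ x = 0
      · have hgx : g x = 0 := by
          have := hgn x
          rw [h0] at this
          exact norm_le_zero_iff.1 this
        have hrx : r f x = 0 := by simp [r, hgx]
        rw [ContinuousAt, hrx]
        refine squeeze_zero_norm (hrg f hf) ?_
        have := cg.norm.tendsto x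
        rwa [hgx, norm_zero] at this
      · exact (Complex.continuous_ofReal.continuousAt.comp
          (c3.continuousAt.div (c1.add c2).continuousAt h0)).mul cg.continuousAt
    have hsupp : ∀ f : C_c(X, ℝ≥0), HasCompactSupport (r f) := by
      intro f
      refine f.hasCompactSupport.mono fun x hx => ?_
      rw [Function.mem_support] at hx ⊢
      intro h
      exact hx (by simp [r, h])
    have hf₁ : ∀ x, f₁ x ≤ f₁ x + f₂ x := fun x => le_self_add
    have hf₂ : ∀ x, f₂ x ≤ f₁ x + f₂ x := fun x => le_add_self
    let g₁ := c0OfCompactSupport (r f₁) (hcont f₁ hf₁) (hsupp f₁)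
    let g₂ := c0OfCompactSupport (r f₂) (hcont f₂ hf₂) (hsupp f₂)
    have hsum : g = g₁ + g₂ := by
      ext x
      change g x = r f₁ x + r f₂ x
      by_cases h0 : (f₁ x : ℝ) + f₂ x = 0
      · have hgx : g x = 0 := by
          have := hgn x
          rw [h0] at this
          exact norm_le_zero_iff.1 this
        simp [r, hgx]
      · simp only [r]
        rw [← add_mul, ← Complex.ofReal_add, ← add_div, div_self h0]
        simp
    rw [hsum, map_add]
    exact (nnnorm_add_le _ _).trans (add_le_add (le_absFunctional Λ g₁ (hrf f₁))
      (le_absFunctional Λ g₂ (hrf f₂)))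
  · have key : ∀ g₁ : C₀(X, ℂ), (∀ x, ‖g₁ x‖₊ ≤ f₁ x) → ∀ g₂ : C₀(X, ℂ), (∀ x, ‖g₂ x‖₊ ≤ f₂ x) →
        ‖Λ g₁‖₊ + ‖Λ g₂‖₊ ≤ absFunctional Λ (f₁ + f₂) := by
      intro g₁ h₁ g₂ h₂
      obtain ⟨c₁, hc₁, e₁⟩ := exists_unimodular (Λ g₁)
      obtain ⟨c₂, hc₂, e₂⟩ := exists_unimodular (Λ g₂)
      have h := le_absFunctional Λ (f := f₁ + f₂) (c₁ • g₁ + c₂ • g₂) (fun x => by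
        change ‖c₁ * g₁ x + c₂ * g₂ x‖₊ ≤ f₁ x + f₂ x
        refine (nnnorm_add_le _ _).trans ?_
        rw [nnnorm_mul, nnnorm_mul]
        exact add_le_add ((mul_le_of_le_one_left (by positivity) hc₁).trans (h₁ x))
          ((mul_le_of_le_one_left (by positivity) hc₂).trans (h₂ x)))
      have e : Λ (c₁ • g₁ + c₂ • g₂) = ((‖Λ g₁‖ + ‖Λ g₂‖ : ℝ) : ℂ) := by
        rw [map_add, map_smul, map_smul, smul_eq_mul, smul_eq_mul, e₁, e₂, Complex.ofReal_add]
      refine le_trans (le_of_eq ?_) h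
      rw [e, ← NNReal.coe_inj]
      simp only [NNReal.coe_add, coe_nnnorm, Complex.norm_real, Real.norm_eq_abs]
      rw [abs_of_nonneg (by positivity)]
    have step : ∀ g₂ : C₀(X, ℂ), (∀ x, ‖g₂ x‖₊ ≤ f₂ x) →
        absFunctional Λ f₁ ≤ absFunctional Λ (f₁ + f₂) - ‖Λ g₂‖₊ := fun g₂ h₂ =>
      absFunctional_le Λ fun g₁ h₁ => le_tsub_of_add_le_right (key g₁ h₁ g₂ h₂)
    have hle : ∀ g₂ : C₀(X, ℂ), (∀ x, ‖g₂ x‖₊ ≤ f₂ x) →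
        ‖Λ g₂‖₊ ≤ absFunctional Λ (f₁ + f₂) - absFunctional Λ f₁ := by
      intro g₂ h₂
      have h0 : ‖Λ g₂‖₊ ≤ absFunctional Λ (f₁ + f₂) := by
        simpa using key 0 (fun x => by simp) g₂ h₂
      have h1 := (le_tsub_iff_right h0).1 (step g₂ h₂)
      exact le_tsub_of_add_le_left h1
    have hle2 := absFunctional_le Λ hle
    have h1 : absFunctional Λ f₁ ≤ absFunctional Λ (f₁ + f₂) := by
      simpa using step 0 fun x => by simp
    rw [add_comm]
    exact (le_tsub_iff_right h1).1 hle2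

lemma absFunctional_smul_le (c : ℝ≥0) (f : C_c(X, ℝ≥0)) :
    c * absFunctional Λ f ≤ absFunctional Λ (c • f) := by
  rcases eq_or_ne c 0 with rfl | hc
  · simp
  have h : absFunctional Λ f ≤ c⁻¹ * absFunctional Λ (c • f) := by
    refine absFunctional_le Λ fun g hg => ?_
    have h := le_absFunctional Λ (f := c • f) (((c : ℝ) : ℂ) • g) fun x => by
      change ‖((c : ℝ) : ℂ) * g x‖₊ ≤ c * f x
      rw [nnnorm_mul]
      have : ‖((c : ℝ) : ℂ)‖₊ = c := by ext; simp
      rw [this]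
      gcongr
      exact hg x
    rw [map_smul, smul_eq_mul, nnnorm_mul] at h
    have : ‖((c : ℝ) : ℂ)‖₊ = c := by ext; simp
    rw [this] at h
    rw [le_inv_mul_iff₀ (pos_iff_ne_zero.2 hc)]
    exact h
  rwa [le_inv_mul_iff₀ (pos_iff_ne_zero.2 hc)] at h

/-- `absFunctional Λ`, as a positive linear functional. -/
def absLinear : C_c(X, ℝ≥0) →ₗ[ℝ≥0] ℝ≥0 where
  toFun := absFunctional Λ
  map_add' := absFunctional_add Λ
  map_smul' c f := by
    refine le_antisymm ?_ (absFunctional_smul_le Λ c f)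
    rcases eq_or_ne c 0 with rfl | hc
    · refine absFunctional_le Λ fun g hg => ?_
      have : g = 0 := by
        ext x
        have := hg x
        simpa using this
      simp [this]
    · have h := absFunctional_smul_le Λ c⁻¹ (c • f)
      rw [smul_smul, inv_mul_cancel₀ hc, one_smul, inv_mul_le_iff₀ (pos_iff_ne_zero.2 hc)] at h
      exact h

/-- The positive regular measure `|Λ|`. -/
def absMeasure : Measure X := NNRealRMK.rieszMeasure (absLinear Λ)

instance : (absMeasure Λ).Regular := NNRealRMK.rieszMeasure_regular _

instance : IsFiniteMeasure (absMeasure Λ) := by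
  refine ⟨lt_of_le_of_lt ?_ (ENNReal.coe_lt_top (r := ‖Λ‖₊))⟩
  rw [isOpen_univ.measure_eq_iSup_isCompact]
  refine iSup₂_le fun K _ => iSup_le fun hK => ?_
  obtain ⟨φ, hφ1, -, hφc, hφr⟩ := exists_continuous_one_zero_of_isCompact hK isClosed_empty
    (Set.disjoint_empty K)
  let f : C_c(X, ℝ≥0) :=
    { toFun := fun x => (φ x).toNNReal
      continuous_toFun := continuous_real_toNNReal.comp φ.continuous
      hasCompactSupport' := hφc.comp_left Real.toNNReal_zero }
  have hf1 : ∀ x, f x ≤ 1 := fun x => Real.toNNReal_le_one.2 (hφr x).2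
  have h1 : absMeasure Λ K ≤ ∫⁻ x, f x ∂(absMeasure Λ) := by
    rw [← lintegral_indicator_one hK.measurableSet]
    refine lintegral_mono fun x => ?_
    by_cases hx : x ∈ K
    · have : φ x = 1 := hφ1 hx
      have h2 : f x = 1 := by change (φ x).toNNReal = 1; simp [this]
      simp [hx, h2]
    · simp [hx]
  refine h1.trans ?_
  have h2 : ∫⁻ x, f x ∂(absMeasure Λ) = absLinear Λ f := NNRealRMK.lintegral_rieszMeasure _ f
  rw [h2, ENNReal.coe_le_coe]
  refine absFunctional_le Λ fun g hg => ?_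
  have hg1 : ‖g‖ ≤ 1 := c0_norm_le _ zero_le_one fun x => by
    exact_mod_cast (hg x).trans (hf1 x)
  have := Λ.le_opNorm g
  exact this.trans (mul_le_of_le_one_right (norm_nonneg _) hg1)

lemma norm_le_integral_absMeasure (g : C₀(X, ℂ)) :
    ‖Λ g‖ ≤ ∫ x, ‖g x‖ ∂(absMeasure Λ) := by
  have hcs : ∀ g : C₀(X, ℂ), HasCompactSupport g → ‖Λ g‖ ≤ ∫ x, ‖g x‖ ∂(absMeasure Λ) := by
    intro g hg
    let f : C_c(X, ℝ≥0) :=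
      { toFun := fun x => ‖g x‖₊
        continuous_toFun := (map_continuous g).nnnorm
        hasCompactSupport' := hg.comp_left nnnorm_zero }
    have h1 := le_absFunctional Λ (f := f) g fun x => le_rfl
    have h2 : ∫ x, (f x : ℝ) ∂(absMeasure Λ) = absLinear Λ f :=
      NNRealRMK.integral_rieszMeasure _ f
    have h3 : ∫ x, ‖g x‖ ∂(absMeasure Λ) = absFunctional Λ f := h2
    rw [h3]
    exact h1
  refine le_of_forall_pos_le_add fun ε hε => ?_
  obtain ⟨k, hk, hgk, hkg⟩ := c0_exists_compactSupport g (ε := ε / (‖Λ‖ + 1)) (by positivity)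
  have h1 : ‖Λ (g - k)‖ ≤ ε := by
    calc ‖Λ (g - k)‖ ≤ ‖Λ‖ * ‖g - k‖ := Λ.le_opNorm _
      _ ≤ (‖Λ‖ + 1) * (ε / (‖Λ‖ + 1)) := by gcongr; linarith
      _ = ε := mul_div_cancel₀ _ (by positivity)
  calc ‖Λ g‖ = ‖Λ k + Λ (g - k)‖ := by rw [← map_add]; congr 2; abel
    _ ≤ ‖Λ k‖ + ‖Λ (g - k)‖ := norm_add_le _ _
    _ ≤ ∫ x, ‖g x‖ ∂(absMeasure Λ) + ε := by
        refine add_le_add ((hcs k hk).trans ?_) h1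
        exact integral_mono (c0_integrable _ k).norm (c0_integrable _ g).norm hkg

/-- The map from `C₀(X)` to `L¹(|Λ|)`. -/
def c0ToL1 : C₀(X, ℂ) →ₗ[ℂ] Lp ℂ 1 (absMeasure Λ) where
  toFun g := (c0_integrable (absMeasure Λ) g).toL1 g
  map_add' f g := Integrable.toL1_add _ _ (c0_integrable _ f) (c0_integrable _ g)
  map_smul' c f := Integrable.toL1_smul _ (c0_integrable _ f) c

lemma norm_c0ToL1 (g : C₀(X, ℂ)) : ‖c0ToL1 Λ g‖ = ∫ x, ‖g x‖ ∂(absMeasure Λ) :=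
  L1.norm_of_fun_eq_integral_norm (c0_integrable _ g)

lemma denseRange_c0ToL1 : DenseRange (c0ToL1 Λ) := by
  intro F
  rw [EMetric.mem_closure_iff]
  intro ε hε
  obtain ⟨δ, hδ0, hδ⟩ := exists_between hε
  obtain ⟨g, hg, hgc, hgs⟩ := exists_compactSupport_approx (absMeasure Λ) (L1.integrable_coeFn F)
    hδ0.ne'
  refine ⟨_, ⟨c0OfCompactSupport g hgc hgs, rfl⟩, lt_of_le_of_lt ?_ hδ⟩
  rw [Lp.edist_def]
  refine (le_of_eq (eLpNorm_congr_ae ?_)).trans hg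
  filter_upwards [Integrable.coeFn_toL1
    (c0_integrable (absMeasure Λ) (c0OfCompactSupport g hgc hgs))] with x hx
  change F x - (c0ToL1 Λ (c0OfCompactSupport g hgc hgs)) x = F x - g x
  congr 1

/-- The continuous extension of `Λ` to `L¹(|Λ|)`. -/
def l1Extend : Lp ℂ 1 (absMeasure Λ) →L[ℂ] ℂ :=
  (Λ : C₀(X, ℂ) →ₗ[ℂ] ℂ).extendOfNorm (c0ToL1 Λ)

lemma l1Extend_c0ToL1 (g : C₀(X, ℂ)) : l1Extend Λ (c0ToL1 Λ g) = Λ g :=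
  LinearMap.extendOfNorm_eq (denseRange_c0ToL1 Λ)
    ⟨1, fun g => by
      rw [one_mul, norm_c0ToL1]; exact norm_le_integral_absMeasure Λ g⟩ g

lemma norm_l1Extend_le (F : Lp ℂ 1 (absMeasure Λ)) : ‖l1Extend Λ F‖ ≤ ‖F‖ := by
  have := LinearMap.norm_extendOfNorm_apply_le (f := (Λ : C₀(X, ℂ) →ₗ[ℂ] ℂ))
    (denseRange_c0ToL1 Λ) 1 (fun g => by
      rw [one_mul, norm_c0ToL1]; exact norm_le_integral_absMeasure Λ g) F
  rwa [one_mul] at this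

open Classical in
/-- The set function `E ↦ Λ(1_E)`. -/
def rieszSetFun (E : Set X) : ℂ :=
  if h : MeasurableSet E then
    l1Extend Λ (indicatorConstLp 1 h (measure_ne_top (absMeasure Λ) E) (1 : ℂ)) else 0

lemma rieszSetFun_of_meas {E : Set X} (h : MeasurableSet E) : rieszSetFun Λ E =
    l1Extend Λ (indicatorConstLp 1 h (measure_ne_top (absMeasure Λ) E) (1 : ℂ)) := by
  rw [rieszSetFun, dif_pos h]

lemma enorm_rieszSetFun_le (E : Set X) : ‖rieszSetFun Λ E‖ₑ ≤ absMeasure Λ E := by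
  by_cases h : MeasurableSet E
  · rw [rieszSetFun_of_meas Λ h]
    have h1 := norm_l1Extend_le Λ (indicatorConstLp 1 h (measure_ne_top (absMeasure Λ) E) (1 : ℂ))
    rw [norm_indicatorConstLp one_ne_zero ENNReal.one_ne_top] at h1
    simp only [norm_one, ENNReal.toReal_one, div_one, Real.rpow_one, one_mul] at h1
    rw [← ofReal_norm]
    exact ENNReal.ofReal_le_of_le_toReal h1
  · simp [rieszSetFun, h]

/-- The complex measure representing `Λ`. -/
def rieszComplexMeasure : ComplexMeasure X :=
  VectorMeasure.of_additive_of_le_measure (μ := absMeasure Λ) (rieszSetFun Λ)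
    (enorm_rieszSetFun_le Λ)
    (fun s t hs ht hst => by
      rw [rieszSetFun_of_meas Λ hs, rieszSetFun_of_meas Λ ht, rieszSetFun_of_meas Λ (hs.union ht),
        ← map_add, indicatorConstLp_disjoint_union hs ht _ _ hst])
    (fun s hs => by simp [rieszSetFun, hs])

lemma rieszComplexMeasure_apply (E : Set X) : rieszComplexMeasure Λ E = rieszSetFun Λ E := rfl

lemma variation_rieszComplexMeasure_le : (rieszComplexMeasure Λ).variation ≤ absMeasure Λ :=
  VectorMeasure.variation_le_of_forall_enorm_le fun E _ => enorm_rieszSetFun_le Λ E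

lemma cIntegral_rieszComplexMeasure {f : X → ℂ} (hf : Integrable f (absMeasure Λ)) :
    ∀ hf' : Integrable f (absMeasure Λ),
      cIntegral (rieszComplexMeasure Λ) f = l1Extend Λ (hf'.toL1 f) := by
  have hmono : ∀ {f : X → ℂ}, Integrable f (absMeasure Λ) →
      Integrable f (rieszComplexMeasure Λ).variation := fun h =>
    h.mono_measure (variation_rieszComplexMeasure_le Λ)
  refine Integrable.induction (μ := absMeasure Λ) (fun f => ∀ hf' : Integrable f (absMeasure Λ),
      cIntegral (rieszComplexMeasure Λ) f = l1Extend Λ (hf'.toL1 f)) ?_ ?_ ?_ ?_ hf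
  · intro c s hs hsμ hf'
    rw [cIntegral_indicator _ hs, rieszComplexMeasure_apply, rieszSetFun_of_meas Λ hs,
      ← smul_eq_mul, ← map_smul]
    congr 1
    ext1
    filter_upwards [Integrable.coeFn_toL1 hf', Lp.coeFn_smul c
      (indicatorConstLp 1 hs (measure_ne_top (absMeasure Λ) s) (1 : ℂ)),
      indicatorConstLp_coeFn (p := 1) (hs := hs) (hμs := measure_ne_top (absMeasure Λ) s)
        (c := (1 : ℂ))] with x h1 h2 h3
    rw [h1, h2, Pi.smul_apply, h3]
    by_cases hx : x ∈ s <;> simp [hx]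
  · intro f g _ hfi hgi hf hg hfg
    have h1 : cIntegral (rieszComplexMeasure Λ) (f + g) =
        cIntegral (rieszComplexMeasure Λ) f + cIntegral (rieszComplexMeasure Λ) g :=
      cIntegral_add _ (hmono hfi) (hmono hgi)
    rw [h1, hf hfi, hg hgi, ← map_add, ← Integrable.toL1_add]
  · have hset : {f : Lp ℂ 1 (absMeasure Λ) | ∀ hf' : Integrable f (absMeasure Λ),
        cIntegral (rieszComplexMeasure Λ) f = l1Extend Λ (hf'.toL1 f)} =
        {f : Lp ℂ 1 (absMeasure Λ) | cIntegral (rieszComplexMeasure Λ) f = l1Extend Λ f} := by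
      ext f
      simp only [Set.mem_ofPred_eq, Integrable.toL1_coeFn]
      exact ⟨fun h => h (L1.integrable_coeFn f), fun h _ => h⟩
    rw [hset]
    refine isClosed_eq ?_ (l1Extend Λ).continuous
    refine (LipschitzWith.of_dist_le_mul (K := 1) fun f g => ?_).continuous
    rw [dist_eq_norm, ← cIntegral_sub _ (hmono (L1.integrable_coeFn f))
      (hmono (L1.integrable_coeFn g)), NNReal.coe_one, one_mul, L1.dist_eq_integral_dist]
    refine (norm_cIntegral_le _ _).trans ?_
    simp only [dist_eq_norm]
    exact integral_mono_measure (variation_rieszComplexMeasure_le Λ)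
      (Eventually.of_forall fun x => norm_nonneg _)
      ((L1.integrable_coeFn f).sub (L1.integrable_coeFn g)).norm
  · intro f g hfg hfi hf hgi
    have h1 : cIntegral (rieszComplexMeasure Λ) f = cIntegral (rieszComplexMeasure Λ) g :=
      VectorMeasure.integral_congr_ae
        ((Measure.absolutelyContinuous_of_le (variation_rieszComplexMeasure_le Λ)).ae_eq hfg)
    rw [← h1, hf hfi]
    congr 1
    exact (Integrable.toL1_eq_toL1_iff _ _ _ _).2 hfg

lemma RegMeasure.exists_toDual_eq : ∃ μ : RegMeasure X, μ.toDual = Λ := by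
  refine ⟨⟨rieszComplexMeasure Λ,
    regular_of_le_regular (variation_rieszComplexMeasure_le Λ)⟩, ?_⟩
  ext g
  have h := cIntegral_rieszComplexMeasure Λ (c0_integrable _ g) (c0_integrable _ g)
  exact h.trans (l1Extend_c0ToL1 Λ g)

end Surjective

variable (X) in
/-- The Riesz representation theorem: `μ ↦ (f ↦ ∫ f dμ)` identifies `M(X)` isometrically with the
dual of `C₀(X)`. -/
def RegMeasure.riesz : RegMeasure X ≃ₗᵢ[ℂ] StrongDual ℂ C₀(X, ℂ) :=
  LinearIsometryEquiv.ofSurjective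
    { toFun := RegMeasure.toDual
      map_add' := fun μ ν => by
        ext f
        exact cIntegral_add_measure μ.1 ν.1 (c0_integrable _ f) (c0_integrable _ f)
      map_smul' := fun c μ => by
        ext f
        exact cIntegral_smul_measure c μ.1 (c0_integrable _ f)
      norm_map' := RegMeasure.norm_toDual }
    RegMeasure.exists_toDual_eq

@[simp] lemma RegMeasure.riesz_apply (μ : RegMeasure X) (f : C₀(X, ℂ)) :
    RegMeasure.riesz X μ f = cIntegral μ.1 f := rfl

instance : CompleteSpace (RegMeasure X) :=
  (RegMeasure.riesz X).toIsometryEquiv.completeSpace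

end RegularMeasures

section GroupAlgebra

variable (G : Type u) [Group G] [TopologicalSpace G] [IsTopologicalGroup G]
  [LocallyCompactSpace G] [T2Space G] [MeasurableSpace G] [BorelSpace G]

/-- The space `L¹(G)` with respect to the left Haar measure. -/
abbrev GroupL1 : Type u := Lp ℂ 1 (Measure.haar : Measure G)

variable {G}

/-- Left translation `(L_s g)(x) = g (s⁻¹ x)`, as an isometry of `L¹(G)`. -/
def GroupL1.translate (s : G) : GroupL1 G →ₗᵢ[ℂ] GroupL1 G :=
  Lp.compMeasurePreservingₗᵢ ℂ (fun x : G => s⁻¹ * x) (measurePreserving_mul_left Measure.haar s⁻¹)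

lemma GroupL1.translate_ae (s : G) (g : GroupL1 G) :
    GroupL1.translate s g =ᵐ[Measure.haar] fun x => g (s⁻¹ * x) :=
  Lp.coeFn_compMeasurePreserving g (measurePreserving_mul_left Measure.haar s⁻¹)

lemma GroupL1.translate_eq_smul (s : G) (g : Lp ℂ 1 (Measure.haar : Measure G)) :
    GroupL1.translate s g = DomMulAct.mk s⁻¹ • g := rfl

lemma GroupL1.continuous_translate (g : GroupL1 G) :
    Continuous fun s : G => GroupL1.translate s g := by
  have : Fact ((1 : ℝ≥0∞) ≠ ∞) := ⟨ENNReal.one_ne_top⟩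
  have h : Continuous fun s : G =>
      DomMulAct.mk s⁻¹ • (g : Lp ℂ 1 (Measure.haar : Measure G)) := by
    have : Continuous fun s : G => DomMulAct.mk s⁻¹ :=
      DomMulAct.continuous_mk.comp continuous_inv
    fun_prop
  exact h

lemma GroupL1.translate_translate (s t : G) (g : GroupL1 G) :
    GroupL1.translate s (GroupL1.translate t g) = GroupL1.translate (s * t) g := by
  have := smul_smul (DomMulAct.mk s⁻¹) (DomMulAct.mk t⁻¹) (g : Lp ℂ 1 (Measure.haar : Measure G))
  rw [← DomMulAct.mk_mul, ← mul_inv_rev] at this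
  exact this

lemma GroupL1.integrable (f : GroupL1 G) : Integrable f (Measure.haar : Measure G) :=
  L1.integrable_coeFn f

lemma GroupL1.aestronglyMeasurable_smul (f g : GroupL1 G) :
    AEStronglyMeasurable (fun s => f s • GroupL1.translate s g) (Measure.haar : Measure G) := by
  have key : ∀ n : ℕ, ∃ k : G → ℂ,
      eLpNorm (⇑f - k) 1 (Measure.haar : Measure G) ≤ ENNReal.ofReal (1 / 2 ^ n) ∧
      Continuous k ∧ HasCompactSupport k := fun n =>
    exists_compactSupport_approx _ (GroupL1.integrable f) (by simp)
  choose k hk2 hk3 hk1 using key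
  have hlim : Tendsto (fun n => eLpNorm (k n - ⇑f) 1 (Measure.haar : Measure G)) atTop (𝓝 0) := by
    have h0 : Tendsto (fun n : ℕ => ENNReal.ofReal (1 / 2 ^ n)) atTop (𝓝 0) := by
      rw [← ENNReal.ofReal_zero]
      refine ENNReal.tendsto_ofReal ?_
      simp only [one_div]
      exact tendsto_inv_atTop_zero.comp
        (tendsto_pow_atTop_atTop_of_one_lt (one_lt_two (α := ℝ)))
    refine tendsto_of_tendsto_of_tendsto_of_le_of_le tendsto_const_nhds h0
      (fun _ => zero_le) fun n => ?_
    rw [eLpNorm_sub_comm]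
    exact hk2 n
  obtain ⟨ns, -, hns⟩ := (tendstoInMeasure_of_tendsto_eLpNorm one_ne_zero
    (fun n => ((hk3 n).stronglyMeasurable_of_hasCompactSupport (hk1 n)).aestronglyMeasurable) (GroupL1.integrable f).1 hlim).exists_seq_tendsto_ae
  refine aestronglyMeasurable_of_tendsto_ae atTop
    (f := fun n s => k (ns n) s • GroupL1.translate s g) (fun n => ?_) ?_
  · have hc : Continuous fun s => k (ns n) s • GroupL1.translate s g :=
      (hk3 _).smul (GroupL1.continuous_translate g)
    exact (hc.stronglyMeasurable_of_hasCompactSupport (hk1 _).smul_right).aestronglyMeasurable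
  · filter_upwards [hns] with s hs
    exact hs.smul_const _

lemma GroupL1.integrable_smul (f g : GroupL1 G) :
    Integrable (fun s => f s • GroupL1.translate s g) (Measure.haar : Measure G) := by
  refine Integrable.mono' ((GroupL1.integrable f).norm.mul_const ‖g‖)
    (GroupL1.aestronglyMeasurable_smul f g) (Eventually.of_forall fun s => ?_)
  rw [norm_smul, LinearIsometry.norm_map]

/-- Convolution on `L¹(G)`: `f * g = ∫ f(s) L_s g ds`, that is,
`(f * g)(x) = ∫ f(s) g(s⁻¹ x) ds` for almost every `x`. -/
instance : Mul (GroupL1 G) :=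
  ⟨fun f g => ∫ s, f s • GroupL1.translate s g ∂(Measure.haar : Measure G)⟩

lemma GroupL1.mul_def (f g : GroupL1 G) :
    f * g = ∫ s, f s • GroupL1.translate s g ∂(Measure.haar : Measure G) := rfl

lemma GroupL1.norm_eq (f : GroupL1 G) : ‖f‖ = ∫ s, ‖f s‖ ∂(Measure.haar : Measure G) :=
  L1.norm_eq_integral_norm f

lemma GroupL1.norm_mul_le' (f g : GroupL1 G) : ‖f * g‖ ≤ ‖f‖ * ‖g‖ := by
  rw [GroupL1.mul_def]
  refine (norm_integral_le_integral_norm _).trans (le_of_eq ?_)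
  simp_rw [norm_smul, LinearIsometry.norm_map]
  rw [integral_mul_const, ← GroupL1.norm_eq]

lemma GroupL1.add_mul' (f f' g : GroupL1 G) : (f + f') * g = f * g + f' * g := by
  rw [GroupL1.mul_def, GroupL1.mul_def, GroupL1.mul_def,
    ← integral_add (GroupL1.integrable_smul f g) (GroupL1.integrable_smul f' g)]
  refine integral_congr_ae ?_
  have h : ⇑(f + f') =ᵐ[Measure.haar] ⇑f + ⇑f' := Lp.coeFn_add _ _
  filter_upwards [h] with s hs
  rw [hs, Pi.add_apply, add_smul]

lemma GroupL1.smul_mul' (c : ℂ) (f g : GroupL1 G) : (c • f) * g = c • (f * g) := by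
  rw [GroupL1.mul_def, GroupL1.mul_def, ← integral_smul]
  refine integral_congr_ae ?_
  have h : ⇑(c • f) =ᵐ[Measure.haar] c • ⇑f := Lp.coeFn_smul _ _
  filter_upwards [h] with s hs
  rw [hs, Pi.smul_apply, smul_assoc]

/-- Right convolution by a fixed `g`, as a bounded operator on `L¹(G)`. -/
def GroupL1.mulRightL (g : GroupL1 G) : GroupL1 G →L[ℂ] GroupL1 G :=
  LinearMap.mkContinuous
    { toFun := fun f => f * g
      map_add' := fun f f' => GroupL1.add_mul' f f' g
      map_smul' := fun c f => GroupL1.smul_mul' c f g } ‖g‖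
    fun f => (GroupL1.norm_mul_le' f g).trans (le_of_eq (mul_comm _ _))

lemma GroupL1.translate_mul (s : G) (f g : GroupL1 G) :
    GroupL1.translate s (f * g) = GroupL1.translate s f * g := by
  rw [GroupL1.mul_def, GroupL1.mul_def]
  have h1 := (GroupL1.translate (G := G) s).toContinuousLinearMap.integral_comp_comm
    (GroupL1.integrable_smul f g)
  rw [LinearIsometry.coe_toContinuousLinearMap] at h1
  rw [← h1, ← integral_mul_left_eq_self _ s⁻¹]
  refine integral_congr_ae ?_
  filter_upwards [GroupL1.translate_ae s f] with x hx
  rw [hx, map_smul, GroupL1.translate_translate, mul_inv_cancel_left]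

instance : NonUnitalNormedRing (GroupL1 G) :=
  { (inferInstance : NormedAddCommGroup (GroupL1 G)),
    (inferInstance : Mul (GroupL1 G)) with
    left_distrib := fun f g h => by
      rw [GroupL1.mul_def, GroupL1.mul_def, GroupL1.mul_def,
        ← integral_add (GroupL1.integrable_smul f g) (GroupL1.integrable_smul f h)]
      simp_rw [map_add, smul_add]
    right_distrib := fun f f' g => GroupL1.add_mul' f f' g
    zero_mul := fun g => (GroupL1.mulRightL g).map_zero
    mul_zero := fun f => by simp [GroupL1.mul_def]
    mul_assoc := fun f g h => by
      have h1 := (GroupL1.mulRightL h).integral_comp_comm (GroupL1.integrable_smul f g)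
      calc f * g * h = GroupL1.mulRightL h (f * g) := rfl
        _ = ∫ s, GroupL1.mulRightL h (f s • GroupL1.translate s g)
              ∂(Measure.haar : Measure G) := h1.symm
        _ = ∫ s, f s • GroupL1.translate s (g * h) ∂(Measure.haar : Measure G) := by
            refine integral_congr_ae (Eventually.of_forall fun s => ?_)
            simp only [map_smul, GroupL1.translate_mul]
            rfl
        _ = f * (g * h) := rfl
    norm_mul_le := GroupL1.norm_mul_le' }

instance : IsScalarTower ℂ (GroupL1 G) (GroupL1 G) :=
  ⟨fun c f g => GroupL1.smul_mul' c f g⟩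

instance : SMulCommClass ℂ (GroupL1 G) (GroupL1 G) :=
  ⟨fun c f g => by
    simp only [smul_eq_mul, GroupL1.mul_def, map_smul]
    rw [← integral_smul]
    simp_rw [smul_comm c]⟩

end GroupAlgebra

section MeasureAlgebra

variable {G : Type u} [Group G] [TopologicalSpace G] [IsTopologicalGroup G]
  [LocallyCompactSpace G] [T2Space G] [MeasurableSpace G] [BorelSpace G]

/-- The function `t ↦ f (s t)`, as an element of `C₀(G)`. -/
def c0Shift (f : C₀(G, ℂ)) (s : G) : C₀(G, ℂ) where
  toFun := fun t => f (s * t)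
  continuous_toFun := (map_continuous f).comp (continuous_const_mul s)
  zero_at_infty' := f.zero_at_infty'.comp (Homeomorph.mulLeft s).isClosedEmbedding.tendsto_cocompact

@[simp] lemma c0Shift_apply (f : C₀(G, ℂ)) (s t : G) : c0Shift f s t = f (s * t) := rfl

lemma norm_c0Shift_le (f : C₀(G, ℂ)) (s : G) : ‖c0Shift f s‖ ≤ ‖f‖ :=
  c0_norm_le _ (norm_nonneg f) fun t => c0_bound f (s * t)

lemma continuous_c0Shift (f : C₀(G, ℂ)) : Continuous fun s => c0Shift f s := by
  let _ : UniformSpace G := IsTopologicalGroup.rightUniformSpace G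
  have huc : UniformContinuous f := ZeroAtInftyContinuousMap.uniformContinuous f
  rw [continuous_iff_continuousAt]
  intro s
  rw [ContinuousAt, Metric.tendsto_nhds]
  intro ε hε
  have h2 : ∀ᶠ p in uniformity G, dist (f p.1) (f p.2) < ε / 2 :=
    huc (Metric.dist_mem_uniformity (half_pos hε))
  have h3 : ∀ᶠ h in 𝓝 (1 : G), ∀ u : G, dist (f u) (f (h * u)) < ε / 2 := by
    obtain ⟨N, hN, hNs⟩ := Filter.mem_comap.1 h2
    filter_upwards [hN] with h hh u
    refine @hNs (u, h * u) ?_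
    simpa using hh
  have h4 : Tendsto (fun r : G => r * s⁻¹) (𝓝 s) (𝓝 1) := by
    have : Continuous fun r : G => r * s⁻¹ := continuous_mul_const _
    simpa using this.tendsto s
  filter_upwards [h4.eventually h3] with r hr
  refine lt_of_le_of_lt ?_ (half_lt_self hε)
  rw [dist_eq_norm]
  refine c0_norm_le _ (half_pos hε).le fun t => ?_
  have h5 := hr (s * t)
  rw [mul_assoc, inv_mul_cancel_left, dist_comm, dist_eq_norm] at h5
  exact h5.le

lemma setIntegral_le_of_small_values (m : Measure G) [IsFiniteMeasure m] {h : G → ℝ}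
    (hi : Integrable h m) {K : Set G} (hK : MeasurableSet K) {c ε : ℝ} (hc : 0 ≤ c)
    (hε : 0 < ε) (hmc : m.real Set.univ ≤ c) (hb : ∀ t ∈ K, h t ≤ ε / (4 * (c + 1))) :
    ∫ t in K, h t ∂m ≤ ε / 4 := by
  calc ∫ t in K, h t ∂m ≤ ∫ t in K, ε / (4 * (c + 1)) ∂m :=
        setIntegral_mono_on hi.integrableOn (integrable_const _) hK hb
    _ = m.real K * (ε / (4 * (c + 1))) := by simp
    _ ≤ (c + 1) * (ε / (4 * (c + 1))) := by
        have h1 : m.real K ≤ m.real Set.univ := measureReal_mono (Set.subset_univ _)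
        exact mul_le_mul_of_nonneg_right (by linarith) (by positivity)
    _ = ε / 4 := by field_simp

lemma setIntegral_le_of_small_set (m : Measure G) [IsFiniteMeasure m] {h : G → ℝ}
    (hi : Integrable h m) {K : Set G} {c ε : ℝ} (hc : 0 ≤ c)
    (hε : 0 < ε) (hm : m K < ENNReal.ofReal (ε / (4 * (c + 1)))) (hb : ∀ t, h t ≤ c) :
    ∫ t in K, h t ∂m ≤ ε / 4 := by
  calc ∫ t in K, h t ∂m ≤ ∫ t in K, c ∂m :=
        integral_mono hi.integrableOn (integrable_const _) hb
    _ = m.real K * c := by simp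
    _ ≤ (ε / (4 * (c + 1))) * (c + 1) := by
        have h1 : m.real K ≤ ε / (4 * (c + 1)) :=
          ENNReal.toReal_le_of_le_ofReal (by positivity) hm.le
        exact mul_le_mul h1 (by linarith) hc (by positivity)
    _ = ε / 4 := by field_simp

open scoped Pointwise in
lemma eventually_integral_lt (m : Measure G) [IsFiniteMeasure m] [m.Regular]
    (f : C₀(G, ℂ)) {ε : ℝ} (hε : 0 < ε) :
    ∀ᶠ s in cocompact G, ∫ t, ‖f (s * t)‖ ∂m < ε := by
  obtain ⟨K, -, hK, hKm⟩ := MeasurableSet.univ.exists_isCompact_sdiff_lt (μ := m)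
    (measure_ne_top m _) (ε := ENNReal.ofReal (ε / (4 * (‖f‖ + 1))))
    (by simp only [ne_eq, ENNReal.ofReal_eq_zero, not_le]; positivity)
  have h1 : ∀ᶠ x in cocompact G, ‖f x‖ < ε / (4 * (m.real Set.univ + 1)) := by
    have := (f.zero_at_infty').norm
    rw [norm_zero] at this
    exact this.eventually_lt_const (by positivity)
  obtain ⟨L, hL, hLs⟩ := mem_cocompact.1 h1
  have hLK : IsCompact (L * K⁻¹) := hL.mul hK.inv
  filter_upwards [hLK.compl_mem_cocompact] with s hs
  have hfi : Integrable (fun t => f (s * t)) m := c0_integrable m (c0Shift f s)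
  have hb : ∀ t ∈ K, ‖f (s * t)‖ ≤ ε / (4 * (m.real Set.univ + 1)) := by
    intro t ht
    refine le_of_lt (hLs fun hst => hs ?_)
    exact ⟨s * t, hst, t⁻¹, by simpa using ht, by simp⟩
  have hsplit := integral_add_compl hK.measurableSet hfi.norm
  have i1 := setIntegral_le_of_small_values m hfi.norm hK.measurableSet
    measureReal_nonneg hε le_rfl hb
  rw [← Set.compl_eq_univ_sdiff] at hKm
  have i2 := setIntegral_le_of_small_set m hfi.norm (norm_nonneg f) hε hKm
    fun t => c0_bound f (s * t)
  linarith

lemma RegMeasure.eventually_slice_lt (ν : RegMeasure G) (f : C₀(G, ℂ)) {ε : ℝ} (hε : 0 < ε) :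
    ∀ᶠ s in cocompact G, ‖cIntegral ν.1 fun t => f (s * t)‖ < ε := by
  have : ν.1.variation.Regular := ν.2
  filter_upwards [eventually_integral_lt ν.1.variation f hε] with s hs
  exact (_root_.norm_cIntegral_le _ _).trans_lt hs

lemma RegMeasure.toDual_c0Shift (ν : RegMeasure G) (f : C₀(G, ℂ)) (s : G) :
    ν.toDual (c0Shift f s) = cIntegral ν.1 fun t => f (s * t) := rfl

lemma RegMeasure.continuous_slice (ν : RegMeasure G) (f : C₀(G, ℂ)) :
    Continuous fun s => cIntegral ν.1 fun t => f (s * t) := by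
  have h : Continuous fun s => ν.toDual (c0Shift f s) :=
    (ContinuousLinearMap.continuous ν.toDual).comp (continuous_c0Shift f)
  simpa only [RegMeasure.toDual_c0Shift] using h

/-- The function `s ↦ ∫ f(st) dν(t)`, as an element of `C₀(G)`. -/
def RegMeasure.slice (ν : RegMeasure G) (f : C₀(G, ℂ)) : C₀(G, ℂ) where
  toFun := fun s => cIntegral ν.1 fun t => f (s * t)
  continuous_toFun := ν.continuous_slice f
  zero_at_infty' := by
    rw [Metric.tendsto_nhds]
    intro ε hε
    filter_upwards [ν.eventually_slice_lt f hε] with s hs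
    rwa [dist_zero_right]

@[simp] lemma RegMeasure.slice_apply (ν : RegMeasure G) (f : C₀(G, ℂ)) (s : G) :
    ν.slice f s = cIntegral ν.1 fun t => f (s * t) := rfl

lemma RegMeasure.slice_eq (ν : RegMeasure G) (f : C₀(G, ℂ)) (s : G) :
    ν.slice f s = ν.toDual (c0Shift f s) := rfl

/-- `ν.slice`, as a bounded operator on `C₀(G)`. -/
def RegMeasure.sliceL (ν : RegMeasure G) : C₀(G, ℂ) →L[ℂ] C₀(G, ℂ) :=
  LinearMap.mkContinuous
    { toFun := ν.slice
      map_add' := fun f g => by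
        ext s
        exact map_add ν.toDual (c0Shift f s) (c0Shift g s)
      map_smul' := fun c f => by
        ext s
        exact map_smul ν.toDual c (c0Shift f s) } ‖ν‖
    fun f => c0_norm_le _ (by positivity) fun s =>
      (ν.norm_cIntegral_le (c0Shift f s)).trans 
        (mul_le_mul_of_nonneg_left (norm_c0Shift_le f s) (norm_nonneg ν))

@[simp] lemma RegMeasure.sliceL_apply (ν : RegMeasure G) (f : C₀(G, ℂ)) (s : G) :
    ν.sliceL f s = cIntegral ν.1 fun t => f (s * t) := rfl

lemma RegMeasure.norm_sliceL_le (ν : RegMeasure G) : ‖ν.sliceL‖ ≤ ‖ν‖ :=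
  LinearMap.mkContinuous_norm_le _ (norm_nonneg ν) _

/-- The convolution `μ * ν` is the regular complex measure with
`∫ f d(μ * ν) = ∫ (∫ f(st) dν(t)) dμ(s)` for all `f` in `C₀(G)`. -/
instance : Mul (RegMeasure G) :=
  ⟨fun μ ν => (RegMeasure.riesz G).symm (μ.toDual.comp ν.sliceL)⟩

lemma RegMeasure.riesz_mul (μ ν : RegMeasure G) :
    RegMeasure.riesz G (μ * ν) = (RegMeasure.riesz G μ).comp ν.sliceL :=
  (RegMeasure.riesz G).apply_symm_apply _

lemma RegMeasure.cIntegral_mul (μ ν : RegMeasure G) (f : C₀(G, ℂ)) :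
    cIntegral (μ * ν).1 f = cIntegral μ.1 fun s => cIntegral ν.1 fun t => f (s * t) :=
  DFunLike.congr_fun (RegMeasure.riesz_mul μ ν) f

lemma RegMeasure.ext_riesz {μ ν : RegMeasure G}
    (h : RegMeasure.riesz G μ = RegMeasure.riesz G ν) : μ = ν :=
  (RegMeasure.riesz G).injective h

lemma RegMeasure.sliceL_mul (μ ν : RegMeasure G) :
    (μ * ν).sliceL = μ.sliceL.comp ν.sliceL := by
  ext f s
  have h := RegMeasure.cIntegral_mul μ ν (c0Shift f s)
  simp only [RegMeasure.sliceL_apply, ContinuousLinearMap.comp_apply]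
  refine h.trans ?_
  simp only [c0Shift_apply, mul_assoc]

lemma RegMeasure.sliceL_add (μ ν : RegMeasure G) : (μ + ν).sliceL = μ.sliceL + ν.sliceL := by
  ext f s
  exact DFunLike.congr_fun (map_add (RegMeasure.riesz G) μ ν) (c0Shift f s)

lemma RegMeasure.sliceL_smul (c : ℂ) (ν : RegMeasure G) : (c • ν).sliceL = c • ν.sliceL := by
  ext f s
  exact DFunLike.congr_fun (map_smul (RegMeasure.riesz G) c ν) (c0Shift f s)

lemma RegMeasure.zero_mul' (μ : RegMeasure G) : 0 * μ = 0 := RegMeasure.ext_riesz <| by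
  rw [RegMeasure.riesz_mul, LinearIsometryEquiv.map_zero, ContinuousLinearMap.zero_comp]

lemma RegMeasure.mul_zero' (μ : RegMeasure G) : μ * 0 = 0 := RegMeasure.ext_riesz <| by
  have h : (0 : RegMeasure G).sliceL = 0 := by
    ext f s
    exact DFunLike.congr_fun (LinearIsometryEquiv.map_zero (RegMeasure.riesz G)) (c0Shift f s)
  rw [RegMeasure.riesz_mul, h, LinearIsometryEquiv.map_zero, ContinuousLinearMap.comp_zero]

lemma RegMeasure.mul_add' (μ ν κ : RegMeasure G) : μ * (ν + κ) = μ * ν + μ * κ :=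
  RegMeasure.ext_riesz <| by
    rw [LinearIsometryEquiv.map_add, RegMeasure.riesz_mul, RegMeasure.riesz_mul,
      RegMeasure.riesz_mul, RegMeasure.sliceL_add, ContinuousLinearMap.comp_add]

lemma RegMeasure.add_mul' (μ ν κ : RegMeasure G) : (μ + ν) * κ = μ * κ + ν * κ :=
  RegMeasure.ext_riesz <| by
    rw [LinearIsometryEquiv.map_add, RegMeasure.riesz_mul, RegMeasure.riesz_mul,
      RegMeasure.riesz_mul, LinearIsometryEquiv.map_add, ContinuousLinearMap.add_comp]

lemma RegMeasure.mul_assoc' (μ ν κ : RegMeasure G) : μ * ν * κ = μ * (ν * κ) :=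
  RegMeasure.ext_riesz <| by
    rw [RegMeasure.riesz_mul, RegMeasure.riesz_mul, RegMeasure.riesz_mul, RegMeasure.sliceL_mul,
      ContinuousLinearMap.comp_assoc]

lemma RegMeasure.norm_mul_le' (μ ν : RegMeasure G) : ‖μ * ν‖ ≤ ‖μ‖ * ‖ν‖ := by
  have h := ContinuousLinearMap.opNorm_comp_le (RegMeasure.riesz G μ) ν.sliceL
  rw [← RegMeasure.riesz_mul, LinearIsometryEquiv.norm_map, LinearIsometryEquiv.norm_map] at h
  exact h.trans (mul_le_mul_of_nonneg_left ν.norm_sliceL_le (norm_nonneg μ))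

lemma RegMeasure.smul_mul' (c : ℂ) (μ ν : RegMeasure G) : (c • μ) * ν = c • (μ * ν) :=
  RegMeasure.ext_riesz <| by
    rw [LinearIsometryEquiv.map_smul, RegMeasure.riesz_mul, RegMeasure.riesz_mul,
      LinearIsometryEquiv.map_smul, ContinuousLinearMap.smul_comp]

lemma RegMeasure.mul_smul' (c : ℂ) (μ ν : RegMeasure G) : μ * (c • ν) = c • (μ * ν) :=
  RegMeasure.ext_riesz <| by
    rw [LinearIsometryEquiv.map_smul, RegMeasure.riesz_mul, RegMeasure.riesz_mul,
      RegMeasure.sliceL_smul, ContinuousLinearMap.comp_smul]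

instance : NonUnitalNormedRing (RegMeasure G) :=
  { (inferInstance : NormedAddCommGroup (RegMeasure G)),
    (inferInstance : Mul (RegMeasure G)) with
    left_distrib := RegMeasure.mul_add'
    right_distrib := RegMeasure.add_mul'
    zero_mul := RegMeasure.zero_mul'
    mul_zero := RegMeasure.mul_zero'
    mul_assoc := RegMeasure.mul_assoc'
    norm_mul_le := RegMeasure.norm_mul_le' }

instance : IsScalarTower ℂ (RegMeasure G) (RegMeasure G) :=
  ⟨fun c μ ν => RegMeasure.smul_mul' c μ ν⟩

instance : SMulCommClass ℂ (RegMeasure G) (RegMeasure G) :=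
  ⟨fun c μ ν => (RegMeasure.mul_smul' c μ ν).symm⟩

end MeasureAlgebra

/-! `M(G)` is a retract of `L¹(G)**` in the category of Banach algebras: there are bounded
homomorphisms `θ : M(G) → L¹(G)**` and `π : L¹(G)** → M(G)` with `π ∘ θ = id`. Approximate weak
amenability descends along such a pair (`ApproxWeaklyAmenable.of_retract`): a derivation `D` of
`M(G)` becomes the derivation `π* ∘ D ∘ π` of `L¹(G)**`, and composing the functionals that
approximate it with `θ` gives functionals that approximate `D`.

The map `π` restricts a functional on `L¹(G)*` to `C₀(G)`, which sits in `L¹(G)*` by integration,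
and then applies the Riesz theorem. It is multiplicative because `n · f` again lies in `C₀(G)` for
`f` in `C₀(G)`, where it is the slice of `f` by the measure `π n` (`bidualAct_c0Pairing`).

The map `θ` rests on two facts. First, `L¹(G)` is a closed right ideal of `M(G)`
(`exists_l1ToRegMeasure_eq_mul`), so each `m` acts on `L¹(G)` by `R_m : a ↦ a * m`. Second, a
bounded approximate identity has a weak-star cluster point `E` with `⟨E, φ · a⟩ = ⟨φ, a⟩` and `⟨E,
f⟩ = f(1)` (`exists_mixed_identity`). Put `⟨θ m, φ⟩ = ⟨E, φ ∘ R_m⟩`. The first property of `E` makes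
`θ` multiplicative (`bidualEmbed_mul`). Since `f ∘ R_m` is the slice `s ↦ ∫ f(st) dm(t)`, the second
gives `⟨θ m, f⟩ = ∫ f dm`, which is `π ∘ θ = id` (`bidualRestrict_bidualEmbed`).

The analysis avoids Fubini's theorem: double integrals are vector integrals in `C₀(G)` or `L¹(G)`,
to which a bounded functional is applied. -/

/-! ### Retracts of Banach algebras. -/

section Retract

variable {A B : Type u} [NonUnitalNormedRing A] [NormedSpace ℂ A] [IsScalarTower ℂ A A]
  [SMulCommClass ℂ A A] [NonUnitalNormedRing B] [NormedSpace ℂ B] [IsScalarTower ℂ B B]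
  [SMulCommClass ℂ B B]

/-- Approximate weak amenability passes to retracts in the category of Banach algebras. -/
lemma ApproxWeaklyAmenable.of_retract (θ : B →L[ℂ] A) (π : A →L[ℂ] B)
    (hθ : ∀ a b, θ (a * b) = θ a * θ b) (hπ : ∀ a b, π (a * b) = π a * π b)
    (h : ∀ b, π (θ b) = b) (hA : ApproxWeaklyAmenable A) : ApproxWeaklyAmenable B := by
  intro D hD
  let P : StrongDual ℂ B →L[ℂ] StrongDual ℂ A := (ContinuousLinearMap.compL ℂ A B ℂ).flip π
  let T : StrongDual ℂ A →L[ℂ] StrongDual ℂ B := (ContinuousLinearMap.compL ℂ B A ℂ).flip θ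
  -- Multiplicativity of `π` carries the module actions of `B` to those of `A`, so the Leibniz rule
  -- pulls back.
  have hder : IsDualDerivation (P ∘L D ∘L π) := fun a b => by
    ext c
    change D (π (a * b)) (π c) = D (π a) (π (b * c)) + D (π b) (π (c * a))
    rw [hπ, hD, hπ, hπ]
    rfl
  obtain ⟨ι, i₁, i₂, i₃, x, hx⟩ := hA _ hder
  refine ⟨ι, i₁, i₂, i₃, fun i => T (x i), fun b => ?_⟩
  have hlim := (T.continuous.tendsto _).comp (hx (θ b))
  -- The composite `π ∘ θ` occurs twice, in the argument of `D` and in the argument of its value,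
  -- and is the identity both times.
  have hT : T ((P ∘L D ∘L π) (θ b)) = D b := by
    ext c
    change D (π (θ b)) (π (θ c)) = D b c
    rw [h, h]
  rw [hT] at hlim
  refine hlim.congr fun i => ?_
  ext c
  -- Multiplicativity of `θ` is what makes the inner derivation of `x i` restrict to that of `T (x
  -- i)`.
  change x i (θ c * θ b) - x i (θ b * θ c) = x i (θ (c * b)) - x i (θ (b * c))
  rw [hθ, hθ]

end Retract

/-! ### The homomorphism into the second dual given by a right ideal and a mixed identity. -/

section RightIdeal

variable {A M : Type u} [NonUnitalNormedRing A] [NormedSpace ℂ A] [IsScalarTower ℂ A A]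
  [SMulCommClass ℂ A A] [NonUnitalNormedRing M] [NormedSpace ℂ M] [IsScalarTower ℂ M M]
  [SMulCommClass ℂ M M] (j : A →ₗᵢ[ℂ] M) (hid : ∀ a m, ∃ b, j b = j a * m)

/-- If the image of the isometry `j` is a right ideal, the action of `m` on `A` by
`j (a · m) = j a * m`. -/
def rightIdealAct : M →L[ℂ] A →L[ℂ] A :=
  LinearMap.mkContinuous₂
    -- The chosen preimage is unique because `j` is injective, so linearity in both variables can be
    -- checked after applying `j`; the bound 1 holds because `j` is isometric.
    (LinearMap.mk₂ ℂ (fun m a => (hid a m).choose)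
      (fun m n a => j.injective (by
        rw [map_add, (hid a _).choose_spec, (hid a _).choose_spec, (hid a _).choose_spec, mul_add]))
      (fun c m a => j.injective (by
        rw [map_smul, (hid a _).choose_spec, (hid a _).choose_spec, mul_smul_comm]))
      (fun m a b => j.injective (by
        rw [(hid (a + b) m).choose_spec, map_add, map_add, (hid a m).choose_spec,
          (hid b m).choose_spec, add_mul]))
      (fun c m a => j.injective (by
        rw [(hid (c • a) m).choose_spec, map_smul, map_smul, (hid a m).choose_spec,
          smul_mul_assoc])))
    1 fun m a => by
      rw [LinearMap.mk₂_apply, ← j.norm_map, (hid a m).choose_spec, one_mul, mul_comm ‖m‖,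
        ← j.norm_map a]
      exact norm_mul_le _ _

lemma map_rightIdealAct (m : M) (a : A) : j (rightIdealAct j hid m a) = j a * m :=
  (hid a m).choose_spec

/-- The order is reversed because this is a right action written as an operator on the left. -/
lemma rightIdealAct_mul (m n : M) (a : A) :
    rightIdealAct j hid (m * n) a = rightIdealAct j hid n (rightIdealAct j hid m a) :=
  j.injective (by simp only [map_rightIdealAct, mul_assoc])

/-- Associativity in `M`: right multiplication by `m` commutes with left multiplication by `a`. -/
lemma rightIdealAct_mul_right (hj : ∀ a b, j (a * b) = j a * j b) (m : M) (a b : A) :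
    rightIdealAct j hid m (a * b) = a * rightIdealAct j hid m b :=
  j.injective (by simp only [map_rightIdealAct, hj, mul_assoc])

/-- The map `m ↦ E · m` from `M` to the second dual of `A`, for `E` in this second dual. -/
def bidualEmbed (E : StrongDual ℂ (StrongDual ℂ A)) : M →L[ℂ] ArensBidual A :=
  (ArensBidual.toDual (A := A)).symm.toContinuousLinearEquiv.toContinuousLinearMap ∘L
    (ContinuousLinearMap.compL ℂ (StrongDual ℂ A) (StrongDual ℂ A) ℂ E) ∘L
      (ContinuousLinearMap.compL ℂ A A ℂ).flip ∘L rightIdealAct j hid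

lemma toDual_bidualEmbed (E : StrongDual ℂ (StrongDual ℂ A)) (m : M) (φ : StrongDual ℂ A) :
    ArensBidual.toDual (bidualEmbed j hid E m) φ = E (φ.comp (rightIdealAct j hid m)) := rfl

/-- If `E` is a mixed identity, `m ↦ E · m` is multiplicative. -/
lemma bidualEmbed_mul (hj : ∀ a b, j (a * b) = j a * j b) (E : StrongDual ℂ (StrongDual ℂ A))
    (hE : ∀ φ a, E (dualRight φ a) = φ a) (m n : M) :
    bidualEmbed j hid E (m * n) = bidualEmbed j hid E m * bidualEmbed j hid E n := by
  refine ArensBidual.ext' fun φ => ?_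
  rw [ArensBidual.toDual_mul, toDual_bidualEmbed, toDual_bidualEmbed]
  congr 1
  ext a
  change φ (rightIdealAct j hid (m * n) a) = E ((dualRight φ (rightIdealAct j hid m a)).comp
    (rightIdealAct j hid n))
  -- With `R_n` the action of `n` and `c = R_m a`, this is `(φ · c) ∘ R_n = (φ ∘ R_n) · c`. The
  -- mixed identity then evaluates `φ ∘ R_n` at `c`, leaving `φ (R_n (R_m a))`.
  have h : (dualRight φ (rightIdealAct j hid m a)).comp (rightIdealAct j hid n) =
      dualRight (φ.comp (rightIdealAct j hid n)) (rightIdealAct j hid m a) := by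
    ext b
    change φ (_ * _) = φ (rightIdealAct j hid n (_ * _))
    rw [rightIdealAct_mul_right j hid hj]
    rfl
  rw [h, hE, rightIdealAct_mul]
  rfl

end RightIdeal

/-! ### Weak-star cluster points in the second dual. -/

section MixedIdentity

variable {A : Type u} [NormedAddCommGroup A] [NormedSpace ℂ A]

/-- A bounded net has a weak-star cluster point in the second dual. -/
lemma exists_bidual_forall_eq_of_tendsto {ι : Type*} (l : Filter ι) [l.NeBot] (e : ι → A)
    (he : ∀ i, ‖e i‖ ≤ 1) :
    ∃ E : StrongDual ℂ (StrongDual ℂ A), ∀ φ c, Tendsto (fun i => φ (e i)) l (𝓝 c) → E φ = c := by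
  let K : Set (WeakDual ℂ (StrongDual ℂ A)) :=
    WeakDual.toStrongDual ⁻¹' Metric.closedBall 0 1
  have hK : IsCompact K := WeakDual.isCompact_closedBall 0 1
  let F : ι → WeakDual ℂ (StrongDual ℂ A) := fun i =>
    StrongDual.toWeakDual (NormedSpace.inclusionInDoubleDual ℂ A (e i))
  have hF : ∀ i, F i ∈ K := fun i => by
    have h : dist (NormedSpace.inclusionInDoubleDual ℂ A (e i)) 0 ≤ 1 := by
      refine (dist_zero_right (NormedSpace.inclusionInDoubleDual ℂ A (e i))).le.trans ?_
      exact (NormedSpace.double_dual_bound ℂ A (e i)).trans (he i)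
    exact h
  -- By Banach–Alaoglu the net converges along an ultrafilter finer than `l`. One `E` then serves
  -- every `φ`, and it agrees with any limit that already exists along `l`.
  obtain ⟨E, -, hE⟩ := hK.ultrafilter_le_nhds ((Ultrafilter.of l).map F)
    (le_principal_iff.2 (mem_map.2 (univ_mem' hF)))
  refine ⟨WeakDual.toStrongDual E, fun φ c hc => ?_⟩
  have h1 : Tendsto (fun i => F i φ) (Ultrafilter.of l) (𝓝 (E φ)) :=
    ((WeakDual.eval_continuous φ).tendsto E).comp hE
  exact tendsto_nhds_unique h1 (hc.mono_left (Ultrafilter.of_le l))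

end MixedIdentity

/-! ### Integrability of continuous vector-valued functions. -/

section BochnerIntegrability

variable {X : Type u} [TopologicalSpace X] [T2Space X] [LocallyCompactSpace X]
  [MeasurableSpace X] [BorelSpace X] {E : Type*} [NormedAddCommGroup E] [NormedSpace ℂ E]

/-- A continuous vector function times an integrable scalar function is strongly measurable, with
respect to a regular measure. -/
lemma aestronglyMeasurable_smul_of_continuous (μ : Measure X) [μ.Regular] {f : X → ℂ}
    (hf : Integrable f μ) {F : X → E} (hF : Continuous F) :
    AEStronglyMeasurable (fun x => f x • F x) μ := by
  have key : ∀ n : ℕ, ∃ k : X → ℂ, eLpNorm (f - k) 1 μ ≤ ENNReal.ofReal (1 / 2 ^ n) ∧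
      Continuous k ∧ HasCompactSupport k := fun n =>
    exists_compactSupport_approx _ hf (by simp)
  choose k hk2 hk3 hk1 using key
  have hlim : Tendsto (fun n => eLpNorm (k n - f) 1 μ) atTop (𝓝 0) := by
    -- Any errors tending to zero would do: convergence in `L¹` gives convergence in measure, hence
    -- a subsequence converging almost everywhere.
    have h0 : Tendsto (fun n : ℕ => ENNReal.ofReal (1 / 2 ^ n)) atTop (𝓝 0) := by
      rw [← ENNReal.ofReal_zero]
      refine ENNReal.tendsto_ofReal ?_
      simp only [one_div]
      exact tendsto_inv_atTop_zero.comp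
        (tendsto_pow_atTop_atTop_of_one_lt (one_lt_two (α := ℝ)))
    refine tendsto_of_tendsto_of_tendsto_of_le_of_le tendsto_const_nhds h0
      (fun _ => zero_le) fun n => ?_
    rw [eLpNorm_sub_comm]
    exact hk2 n
  obtain ⟨ns, -, hns⟩ := (tendstoInMeasure_of_tendsto_eLpNorm one_ne_zero
    (fun n => ((hk3 n).stronglyMeasurable_of_hasCompactSupport (hk1 n)).aestronglyMeasurable)
    hf.1 hlim).exists_seq_tendsto_ae
  refine aestronglyMeasurable_of_tendsto_ae atTop
    (f := fun n x => k (ns n) x • F x) (fun n => ?_) ?_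
  -- `X` need not be σ-compact nor `E` separable, so `F` alone may fail to be strongly measurable;
  -- multiplied by a compactly supported continuous function it is.
  · have hc : Continuous fun x => k (ns n) x • F x := (hk3 _).smul hF
    exact (hc.stronglyMeasurable_of_hasCompactSupport (hk1 _).smul_right).aestronglyMeasurable
  · filter_upwards [hns] with x hx
    exact hx.smul_const _

lemma integrable_smul_of_continuous (μ : Measure X) [μ.Regular] {f : X → ℂ}
    (hf : Integrable f μ) {F : X → E} (hF : Continuous F) {C : ℝ} (hC : ∀ x, ‖F x‖ ≤ C) :
    Integrable (fun x => f x • F x) μ := by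
  refine Integrable.mono' (hf.norm.mul_const C)
    (aestronglyMeasurable_smul_of_continuous μ hf hF) (Eventually.of_forall fun x => ?_)
  rw [norm_smul]
  exact mul_le_mul_of_nonneg_left (hC x) (norm_nonneg _)

lemma integrable_of_continuous_of_bounded (μ : Measure X) [μ.Regular] [IsFiniteMeasure μ]
    {F : X → E} (hF : Continuous F) {C : ℝ} (hC : ∀ x, ‖F x‖ ≤ C) : Integrable F μ := by
  simpa using integrable_smul_of_continuous μ (integrable_const (1 : ℂ)) hF hC

end BochnerIntegrability

/-! ### The duality between `C₀(X)` and `L¹(μ)`, and the embedding of `L¹(μ)` in `M(X)`. -/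

section Pairing

variable {X : Type u} [TopologicalSpace X] [T2Space X] [LocallyCompactSpace X]
  [MeasurableSpace X] [BorelSpace X] (μ : Measure X)

lemma integrable_mul_c0 (f : C₀(X, ℂ)) {a : X → ℂ} (ha : Integrable a μ) :
    Integrable (fun x => f x * a x) μ :=
  ha.bdd_mul (c0_stronglyMeasurable f).aestronglyMeasurable (Eventually.of_forall (c0_bound f))

lemma norm_integral_mul_c0_le (f : C₀(X, ℂ)) {a : X → ℂ} (ha : Integrable a μ) :
    ‖∫ x, f x * a x ∂μ‖ ≤ ‖f‖ * ∫ x, ‖a x‖ ∂μ := by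
  refine (norm_integral_le_integral_norm _).trans ?_
  rw [← integral_const_mul]
  refine integral_mono (integrable_mul_c0 μ f ha).norm (ha.norm.const_mul _) fun x => ?_
  change ‖f x * a x‖ ≤ ‖f‖ * ‖a x‖
  rw [norm_mul]
  exact mul_le_mul_of_nonneg_right (c0_bound f x) (norm_nonneg _)

/-- The pairing of `C₀(X)` with `L¹(μ)`. -/
def c0Pairing : C₀(X, ℂ) →L[ℂ] StrongDual ℂ (Lp ℂ 1 μ) :=
  LinearMap.mkContinuous₂
    (LinearMap.mk₂ ℂ (fun f a => ∫ x, f x * a x ∂μ)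
      (fun f g a => by
        rw [← integral_add (integrable_mul_c0 μ f (L1.integrable_coeFn a))
          (integrable_mul_c0 μ g (L1.integrable_coeFn a))]
        exact integral_congr_ae (Eventually.of_forall fun x => add_mul (f x) (g x) (a x)))
      (fun c f a => by
        rw [smul_eq_mul, ← integral_const_mul]
        exact integral_congr_ae (Eventually.of_forall fun x => mul_assoc c (f x) (a x)))
      (fun f a b => by
        rw [← integral_add (integrable_mul_c0 μ f (L1.integrable_coeFn a))
          (integrable_mul_c0 μ f (L1.integrable_coeFn b))]
        refine integral_congr_ae ?_
        filter_upwards [Lp.coeFn_add a b] with x hx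
        rw [hx, Pi.add_apply, mul_add])
      (fun c f a => by
        rw [smul_eq_mul, ← integral_const_mul]
        refine integral_congr_ae ?_
        filter_upwards [Lp.coeFn_smul c a] with x hx
        rw [hx, Pi.smul_apply, smul_eq_mul, mul_left_comm])) 1
    fun f a => by
      rw [LinearMap.mk₂_apply, one_mul, L1.norm_eq_integral_norm]
      exact norm_integral_mul_c0_le μ f (L1.integrable_coeFn a)

lemma c0Pairing_apply (f : C₀(X, ℂ)) (a : Lp ℂ 1 μ) :
    c0Pairing μ f a = ∫ x, f x * a x ∂μ := rfl

lemma c0Pairing_toL1 (f : C₀(X, ℂ)) {a : X → ℂ} (ha : Integrable a μ) :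
    c0Pairing μ f (ha.toL1 a) = ∫ x, f x * a x ∂μ := by
  rw [c0Pairing_apply]
  refine integral_congr_ae ?_
  filter_upwards [Integrable.coeFn_toL1 ha] with x hx
  rw [hx]

lemma norm_c0Pairing_le (f : C₀(X, ℂ)) (a : Lp ℂ 1 μ) : ‖c0Pairing μ f a‖ ≤ ‖f‖ * ‖a‖ := by
  rw [L1.norm_eq_integral_norm]
  exact norm_integral_mul_c0_le μ f (L1.integrable_coeFn a)

/-- The approximate phase `conj h / (|h| + δ)` of a compactly supported function recovers its
`L¹`-norm. -/
lemma exists_c0_norm_le_pairing [IsFiniteMeasureOnCompacts μ] {h : X → ℂ} (hc : Continuous h)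
    (hs : HasCompactSupport h) {ε : ℝ} (hε : 0 < ε) :
    ∃ f : C₀(X, ℂ), ‖f‖ ≤ 1 ∧ ∫ x, ‖h x‖ ∂μ ≤ ‖∫ x, f x * h x ∂μ‖ + ε := by
  let K := tsupport h
  have hK : IsCompact K := hs
  -- The phase loses at most `δ` at each point of `K`, so the total loss is at most `δ μ(K) ≤ ε`;
  -- the `+ 1` covers `μ(K) = 0`.
  let δ : ℝ := ε / (μ.real K + 1)
  have hδ : 0 < δ := by positivity
  have hpos : ∀ x, 0 < ‖h x‖ + δ := fun x => by positivity
  let k : X → ℂ := fun x => ((‖h x‖ + δ)⁻¹ : ℝ) * (starRingEnd ℂ) (h x)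
  have hkc : Continuous k :=
    (Complex.continuous_ofReal.comp ((hc.norm.add continuous_const).inv₀ fun x => (hpos x).ne')).mul
      (Complex.continuous_conj.comp hc)
  have hks : HasCompactSupport k := HasCompactSupport.mul_left (hs.comp_left (map_zero _))
  refine ⟨c0OfCompactSupport k hkc hks, c0_norm_le _ zero_le_one fun x => ?_, ?_⟩
  · change ‖k x‖ ≤ 1
    simp only [k, norm_mul, Complex.norm_real, RCLike.norm_conj, norm_inv, Real.norm_eq_abs,
      abs_of_pos (hpos x)]
    rw [inv_mul_le_iff₀ (hpos x)]
    linarith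
  · have hi : Integrable h μ := hc.integrable_of_hasCompactSupport hs
    have hkh : ∀ x, k x * h x = (((‖h x‖ + δ)⁻¹ * ‖h x‖ ^ 2 : ℝ) : ℂ) := fun x => by
      simp only [k]
      rw [mul_assoc, mul_comm _ (h x), Complex.mul_conj, Complex.normSq_eq_norm_sq]
      push_cast
      ring
    have hki : Integrable (fun x => (‖h x‖ + δ)⁻¹ * ‖h x‖ ^ 2) μ := by
      have h1 := (integrable_mul_c0 μ (c0OfCompactSupport k hkc hks) hi).re
      refine h1.congr (Eventually.of_forall fun x => ?_)
      change (k x * h x).re = _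
      rw [hkh, Complex.ofReal_re]
    have hval : ‖∫ x, k x * h x ∂μ‖ = ∫ x, (‖h x‖ + δ)⁻¹ * ‖h x‖ ^ 2 ∂μ := by
      simp_rw [hkh]
      rw [integral_complex_ofReal, Complex.norm_real, Real.norm_eq_abs, abs_of_nonneg]
      exact integral_nonneg fun x => mul_nonneg (inv_nonneg.2 (hpos x).le) (sq_nonneg _)
    change _ ≤ ‖∫ x, k x * h x ∂μ‖ + ε
    rw [hval]
    have hind : Integrable (K.indicator fun _ => δ) μ :=
      (integrable_indicator_iff hK.measurableSet).2 (integrableOn_const hK.measure_ne_top)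
    have hint : ∫ x, K.indicator (fun _ => δ) x ∂μ ≤ ε := by
      rw [integral_indicator_const _ hK.measurableSet, smul_eq_mul]
      have : μ.real K * δ ≤ (μ.real K + 1) * δ := by gcongr; linarith
      rwa [mul_div_cancel₀ _ (by positivity)] at this
    calc ∫ x, ‖h x‖ ∂μ ≤ ∫ x, ((‖h x‖ + δ)⁻¹ * ‖h x‖ ^ 2 + K.indicator (fun _ => δ) x) ∂μ := by
          refine integral_mono hi.norm (hki.add hind) fun x => ?_
          by_cases hx : x ∈ K
          · simp only [Set.indicator_of_mem hx]
            -- The inequality becomes `(‖h x‖ + δ) (‖h x‖ - δ) ≤ ‖h x‖ ^ 2`.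
            rw [← sub_le_iff_le_add, le_inv_mul_iff₀ (hpos x)]
            nlinarith [norm_nonneg (h x)]
          · have : h x = 0 := image_eq_zero_of_notMem_tsupport hx
            simp [this, hx]
      _ = _ := integral_add hki hind
      _ ≤ _ := by gcongr

lemma L1.exists_compactSupport_norm_sub_le [μ.Regular] (a : Lp ℂ 1 μ) {ε : ℝ} (hε : 0 < ε) :
    ∃ (h : X → ℂ) (hc : Continuous h) (hs : HasCompactSupport h),
      ‖a - (hc.integrable_of_hasCompactSupport hs : Integrable h μ).toL1 h‖ ≤ ε := by
  obtain ⟨h, hah, hc, hs⟩ := exists_compactSupport_approx μ (L1.integrable_coeFn a)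
    (ε := ENNReal.ofReal ε) (by simpa using hε)
  refine ⟨h, hc, hs, ?_⟩
  have hi : Integrable h μ := hc.integrable_of_hasCompactSupport hs
  rw [Lp.norm_def]
  refine ENNReal.toReal_le_of_le_ofReal hε.le (le_trans (le_of_eq (eLpNorm_congr_ae ?_)) hah)
  filter_upwards [Lp.coeFn_sub a (hi.toL1 h), Integrable.coeFn_toL1 hi] with x h1 h2
  rw [h1, Pi.sub_apply, Pi.sub_apply, h2]

/-- For a compactly supported continuous function, approximate phases attain the `L¹`-norm up to
`ε`; such functions are dense. This makes the embedding in `M(X)` isometric, hence injective with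
closed range. -/
lemma norm_flip_c0Pairing [μ.Regular] (a : Lp ℂ 1 μ) : ‖(c0Pairing μ).flip a‖ = ‖a‖ := by
  refine le_antisymm (ContinuousLinearMap.opNorm_le_bound _ (norm_nonneg _) fun f => ?_) ?_
  · exact (norm_c0Pairing_le μ f a).trans (le_of_eq (mul_comm _ _))
  refine le_of_forall_pos_le_add fun ε hε => ?_
  obtain ⟨h, hc, hs, hah⟩ := L1.exists_compactSupport_norm_sub_le μ a (ε := ε / 3) (by positivity)
  have hi : Integrable h μ := hc.integrable_of_hasCompactSupport hs
  obtain ⟨f, hf, hfh⟩ := exists_c0_norm_le_pairing μ hc hs (ε := ε / 3) (by positivity)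
  rw [← c0Pairing_toL1 μ f hi, ← L1.norm_of_fun_eq_integral_norm hi] at hfh
  have h1 : ‖a‖ ≤ ‖hi.toL1 h‖ + ε / 3 := by
    have := norm_add_le (a - hi.toL1 h) (hi.toL1 h)
    rw [sub_add_cancel] at this
    linarith
  have h2 : ‖c0Pairing μ f (hi.toL1 h)‖ ≤ ‖c0Pairing μ f a‖ + ε / 3 := by
    have h3 := norm_c0Pairing_le μ f (a - hi.toL1 h)
    rw [map_sub] at h3
    have h4 : ‖f‖ * ‖a - hi.toL1 h‖ ≤ ε / 3 :=
      (mul_le_of_le_one_left (norm_nonneg _) hf).trans hah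
    have h5 := norm_sub_norm_le (c0Pairing μ f (hi.toL1 h)) (c0Pairing μ f a)
    rw [norm_sub_rev] at h5
    linarith
  have h6 : ‖c0Pairing μ f a‖ ≤ ‖(c0Pairing μ).flip a‖ := by
    have := ((c0Pairing μ).flip a).le_opNorm f
    exact this.trans (mul_le_of_le_one_right (norm_nonneg _) hf)
  linarith

/-- The isometric embedding of `L¹(μ)` in the regular complex measures, `a ↦ a dμ`. -/
def l1ToRegMeasure [μ.Regular] : Lp ℂ 1 μ →ₗᵢ[ℂ] RegMeasure X :=
  (RegMeasure.riesz X).symm.toLinearIsometry.comp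
    { toLinearMap := ((c0Pairing μ).flip : Lp ℂ 1 μ →ₗ[ℂ] StrongDual ℂ C₀(X, ℂ))
      norm_map' := norm_flip_c0Pairing μ }

lemma riesz_l1ToRegMeasure [μ.Regular] (a : Lp ℂ 1 μ) (f : C₀(X, ℂ)) :
    RegMeasure.riesz X (l1ToRegMeasure μ a) f = c0Pairing μ f a :=
  DFunLike.congr_fun ((RegMeasure.riesz X).apply_symm_apply ((c0Pairing μ).flip a)) f

/-- Identities in `L¹` can thus be verified by testing against `C₀`, without pointwise computation.
-/
lemma eq_of_forall_c0Pairing_eq [μ.Regular] {a b : Lp ℂ 1 μ}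
    (h : ∀ f, c0Pairing μ f a = c0Pairing μ f b) : a = b :=
  (l1ToRegMeasure μ).injective <| (RegMeasure.riesz X).injective <| by
    ext f
    rw [riesz_l1ToRegMeasure, riesz_l1ToRegMeasure, h]

end Pairing

/-! ### The modular function and right translation in `L¹(G)`. -/

section RightTranslation

variable {G : Type u} [Group G] [TopologicalSpace G] [IsTopologicalGroup G]
  [LocallyCompactSpace G] [T2Space G] [MeasurableSpace G] [BorelSpace G]

/-- Right translations commute with left ones, so the image measure is again left invariant and
regular, and uniqueness of Haar measure applies. -/
lemma map_mul_right_haar (s : G) : (Measure.haar : Measure G).map (· * s) =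
    Measure.modularCharacterFun s • (Measure.haar : Measure G) := by
  rw [Measure.modularCharacterFun_eq_haarScalarFactor Measure.haar]
  have : ((Measure.haar : Measure G).map (· * s)).Regular :=
    Measure.Regular.map (Homeomorph.mulRight s)
  exact Measure.isMulLeftInvariant_eq_smul_of_regular _ _

lemma integral_mul_right_haar {E : Type*} [NormedAddCommGroup E] [NormedSpace ℝ E] (h : G → E)
    (s : G) : ∫ x, h (x * s) ∂(Measure.haar : Measure G) =
      (Measure.modularCharacterFun s : ℝ) • ∫ x, h x ∂(Measure.haar : Measure G) := by
  have h1 := (Homeomorph.mulRight s).measurableEmbedding.integral_map (μ := Measure.haar) h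
  change ∫ x, h x ∂(Measure.haar : Measure G).map (· * s) = ∫ x, h (x * s) ∂_ at h1
  rw [← h1, map_mul_right_haar, integral_smul_nnreal_measure]
  rfl

/-- Continuity is local in the parameter, so a common compact support is needed only over a compact
neighbourhood of each point. -/
lemma continuous_integral_of_locally_compact_support {H : G → G → ℝ}
    (hH : Continuous (Function.uncurry H))
    (hs : ∀ V : Set G, IsCompact V → ∃ K : Set G, IsCompact K ∧ ∀ s ∈ V, ∀ x ∉ K, H s x = 0) :
    Continuous fun s => ∫ x, H s x ∂(Measure.haar : Measure G) := by
  rw [continuous_iff_continuousAt]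
  intro s
  obtain ⟨V, hV, hVs⟩ := exists_compact_mem_nhds s
  obtain ⟨K, hK, hKV⟩ := hs V hV
  exact (continuousOn_integral_of_compact_support hK hH.continuousOn
    fun p x hp hx => hKV p hp x hx).continuousAt hVs

open scoped Pointwise in
lemma exists_compact_forall_mul_notMem {k : G → ℂ} (hk : HasCompactSupport k) {V : Set G}
    (hV : IsCompact V) :
    ∃ K : Set G, IsCompact K ∧ ∀ s ∈ V, ∀ x ∉ K, k (x * s⁻¹) = 0 := by
  refine ⟨tsupport k * V, hk.isCompact.mul hV, fun s hs x hx => ?_⟩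
  refine image_eq_zero_of_notMem_tsupport fun h => hx ?_
  exact ⟨x * s⁻¹, h, s, hs, by simp⟩

/-- The modular function is the ratio `∫ f(xs) dx / ∫ f(x) dx` for a single bump function `f`, and
the numerator is continuous in `s`. -/
lemma continuous_modularCharacterFun :
    Continuous fun s : G => (Measure.modularCharacterFun s : ℝ) := by
  obtain ⟨⟨f, hf⟩, hfs, hf0, hf1⟩ :
    ∃ f : C(G, ℝ), HasCompactSupport f ∧ 0 ≤ f ∧ f 1 ≠ 0 := exists_continuous_nonneg_pos 1
  have hpos : 0 < ∫ x, f x ∂(Measure.haar : Measure G) :=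
    hf.integral_pos_of_hasCompactSupport_nonneg_nonzero hfs hf0 hf1
  have heq : (fun s : G => (Measure.modularCharacterFun s : ℝ)) =
      fun s => (∫ x, f (x * s) ∂(Measure.haar : Measure G)) / ∫ x, f x ∂Measure.haar := by
    ext s
    rw [integral_mul_right_haar f s, smul_eq_mul, mul_div_cancel_right₀ _ hpos.ne']
  rw [heq]
  refine Continuous.div_const (continuous_integral_of_locally_compact_support
    (H := fun s x => f (x * s)) (hf.comp (continuous_snd.mul continuous_fst)) fun V hV => ?_) _
  obtain ⟨K, hK, hKV⟩ := exists_compact_forall_mul_notMem (k := fun x => (f x : ℂ))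
    (hfs.comp_left Complex.ofReal_zero) hV.inv
  refine ⟨K, hK, fun s hs x hx => ?_⟩
  have := hKV s⁻¹ (by simpa using hs) x hx
  simpa using this

/-- The right translate `x ↦ Δ(s) a(x s⁻¹)`, where `Δ` is the modular function normalised so that
the translation preserves integrals. -/
def rightTranslateFun (a : G → ℂ) (s x : G) : ℂ :=
  ((Measure.modularCharacterFun s : ℝ) : ℂ) * a (x * s⁻¹)

variable {a : G → ℂ} (hc : Continuous a) (hs : HasCompactSupport a)

include hc in
lemma continuous_rightTranslateFun :
    Continuous (Function.uncurry (rightTranslateFun a)) := by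
  have h1 : Continuous fun p : G × G => ((Measure.modularCharacterFun p.1 : ℝ) : ℂ) :=
    Complex.continuous_ofReal.comp (continuous_modularCharacterFun.comp continuous_fst)
  exact h1.mul (hc.comp (continuous_snd.mul continuous_fst.inv))

include hc hs in
lemma integrable_rightTranslateFun (s : G) :
    Integrable (rightTranslateFun a s) (Measure.haar : Measure G) := by
  refine Integrable.const_mul ?_ _
  refine Continuous.integrable_of_hasCompactSupport (by fun_prop) ?_
  exact hs.comp_homeomorph (Homeomorph.mulRight s⁻¹)

/-- The factor `Δ(s)` cancels the scaling of Haar measure under `x ↦ x s⁻¹`. -/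
lemma integral_norm_rightTranslateFun (a : G → ℂ) (s : G) :
    ∫ x, ‖rightTranslateFun a s x‖ ∂(Measure.haar : Measure G) = ∫ x, ‖a x‖ ∂Measure.haar := by
  have h := integral_mul_right_haar (fun x => ‖a (x * s⁻¹)‖) s
  simp only [mul_inv_cancel_right] at h
  rw [h, smul_eq_mul, ← integral_const_mul]
  simp [rightTranslateFun]

lemma integral_mul_rightTranslateFun (a f : G → ℂ) (s : G) :
    ∫ x, f x * rightTranslateFun a s x ∂(Measure.haar : Measure G) =
      ∫ x, f (x * s) * a x ∂Measure.haar := by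
  have h := integral_mul_right_haar (fun x => f x * a (x * s⁻¹)) s
  simp only [mul_inv_cancel_right] at h
  rw [h, Complex.real_smul, ← integral_const_mul]
  simp only [rightTranslateFun, mul_left_comm]

/-- Right translation of a compactly supported continuous function, as an element of `L¹(G)`. -/
def rightTranslate (s : G) : GroupL1 G := (integrable_rightTranslateFun hc hs s).toL1 _

lemma norm_rightTranslate (s : G) :
    ‖rightTranslate hc hs s‖ = ∫ x, ‖a x‖ ∂(Measure.haar : Measure G) := by
  rw [rightTranslate, L1.norm_of_fun_eq_integral_norm, integral_norm_rightTranslateFun]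

lemma rightTranslate_one :
    rightTranslate hc hs 1 = (hc.integrable_of_hasCompactSupport hs).toL1 a := by
  simp only [rightTranslate, Integrable.toL1_eq_toL1_iff]
  refine Eventually.of_forall fun x => ?_
  simp [rightTranslateFun, Measure.modularCharacterFun_map_one]

/-- The `L¹`-distance between two translates is a parametric integral whose integrand is jointly
continuous and has compact support locally uniformly in `s`. -/
lemma continuous_rightTranslate : Continuous (rightTranslate hc hs) := by
  have hK := fun V (hV : IsCompact V) => exists_compact_forall_mul_notMem hs hV
  rw [continuous_iff_continuousAt]
  intro s₀
  have hH : Continuous fun s => ∫ x, ‖rightTranslateFun a s x - rightTranslateFun a s₀ x‖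
      ∂(Measure.haar : Measure G) := by
    refine continuous_integral_of_locally_compact_support
      (H := fun s x => ‖rightTranslateFun a s x - rightTranslateFun a s₀ x‖) ?_ fun V hV => ?_
    · have h1 := continuous_rightTranslateFun hc
      have h2 : Continuous fun p : G × G => rightTranslateFun a s₀ p.2 :=
        h1.comp (continuous_const.prodMk continuous_snd)
      exact (h1.sub h2).norm
    -- Adding `s₀` to `V` makes both terms of the difference vanish off the same `K`.
    · obtain ⟨K, hK, hKV⟩ := exists_compact_forall_mul_notMem hs (hV.insert s₀)
      refine ⟨K, hK, fun s hsV x hx => ?_⟩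
      simp [rightTranslateFun, hKV s (Set.mem_insert_of_mem _ hsV) x hx,
        hKV s₀ (Set.mem_insert _ _) x hx]
  have hnorm : ∀ s, dist (rightTranslate hc hs s) (rightTranslate hc hs s₀) =
      ∫ x, ‖rightTranslateFun a s x - rightTranslateFun a s₀ x‖ ∂(Measure.haar : Measure G) := by
    intro s
    rw [dist_eq_norm, rightTranslate, rightTranslate, ← Integrable.toL1_sub,
      L1.norm_of_fun_eq_integral_norm]
    rfl
  rw [ContinuousAt, tendsto_iff_dist_tendsto_zero]
  simp_rw [hnorm]
  simpa using hH.tendsto s₀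

end RightTranslation

/-! ### Convolution by duality; `L¹(G)` as a right ideal of `M(G)`. -/

section Convolution

variable {G : Type u} [Group G] [TopologicalSpace G] [IsTopologicalGroup G]
  [LocallyCompactSpace G] [T2Space G] [MeasurableSpace G] [BorelSpace G]

/-- Evaluation at a point, as a bounded functional on `C₀(G)`. -/
def c0Eval (s : G) : StrongDual ℂ C₀(G, ℂ) :=
  LinearMap.mkContinuous
    { toFun := fun f => f s
      map_add' := fun _ _ => rfl
      map_smul' := fun _ _ => rfl } 1 fun f => by
    rw [one_mul]
    exact c0_bound f s

/-- The function `t ↦ ∫ a(s) f(st) ds`, as an element of `C₀(G)`. -/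
def c0Conv (a : GroupL1 G) (f : C₀(G, ℂ)) : C₀(G, ℂ) :=
  ∫ s, a s • c0Shift f s ∂(Measure.haar : Measure G)

/-- A bounded functional passes through the Bochner integral. Taking for `l` a point evaluation, an
`L¹`-function or a measure yields every interchange of integrals needed below. -/
lemma dual_c0Conv (a : GroupL1 G) (f : C₀(G, ℂ)) (l : StrongDual ℂ C₀(G, ℂ)) :
    l (c0Conv a f) = ∫ s, a s * l (c0Shift f s) ∂(Measure.haar : Measure G) := by
  rw [c0Conv, ← l.integral_comp_comm (integrable_smul_of_continuous _ (L1.integrable_coeFn a)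
    (continuous_c0Shift f) (norm_c0Shift_le f))]
  simp only [map_smul, smul_eq_mul]

lemma c0Conv_apply (a : GroupL1 G) (f : C₀(G, ℂ)) (t : G) :
    c0Conv a f t = ∫ s, a s * f (s * t) ∂(Measure.haar : Measure G) :=
  dual_c0Conv a f (c0Eval t)

lemma c0Pairing_translate (f : C₀(G, ℂ)) (b : GroupL1 G) (s : G) :
    c0Pairing Measure.haar f (GroupL1.translate s b) =
      c0Pairing Measure.haar (c0Shift f s) b := by
  rw [c0Pairing_apply, c0Pairing_apply,
    ← integral_mul_left_eq_self (fun x => c0Shift f s x * b x) s⁻¹]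
  refine integral_congr_ae ?_
  filter_upwards [GroupL1.translate_ae s b] with x hx
  rw [hx, c0Shift_apply, mul_inv_cancel_left]

lemma c0Pairing_mul (f : C₀(G, ℂ)) (a b : GroupL1 G) :
    c0Pairing Measure.haar f (a * b) = c0Pairing Measure.haar (c0Conv a f) b := by
  have h := dual_c0Conv a f ((c0Pairing Measure.haar).flip b)
  rw [GroupL1.mul_def, ← (c0Pairing Measure.haar f).integral_comp_comm
    (GroupL1.integrable_smul a b)]
  simp only [ContinuousLinearMap.flip_apply] at h
  rw [h]
  simp only [map_smul, smul_eq_mul, c0Pairing_translate]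

/-- Both sides are the double integral of `a(s) f(st)` against `ds` and `dm(t)`, taken in the two
orders. -/
lemma riesz_l1_mul (a : GroupL1 G) (m : RegMeasure G) (f : C₀(G, ℂ)) :
    RegMeasure.riesz G (l1ToRegMeasure Measure.haar a * m) f =
      RegMeasure.riesz G m (c0Conv a f) := by
  rw [RegMeasure.riesz_mul, dual_c0Conv, ContinuousLinearMap.comp_apply, riesz_l1ToRegMeasure,
    c0Pairing_apply]
  exact integral_congr_ae (Eventually.of_forall fun s => mul_comm _ _)

lemma l1ToRegMeasure_mul (a b : GroupL1 G) :
    l1ToRegMeasure Measure.haar (a * b) =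
      l1ToRegMeasure Measure.haar a * l1ToRegMeasure Measure.haar b :=
  (RegMeasure.riesz G).injective <| by
    ext f
    rw [riesz_l1_mul, riesz_l1ToRegMeasure, riesz_l1ToRegMeasure, c0Pairing_mul]

/-- The right translate by `s` plays the role of `a * δ_s`. -/
lemma c0Pairing_rightTranslate {a : G → ℂ} (hc : Continuous a) (hs : HasCompactSupport a)
    (f : C₀(G, ℂ)) (s : G) :
    c0Pairing Measure.haar f (rightTranslate hc hs s) =
      c0Conv ((hc.integrable_of_hasCompactSupport hs).toL1 a) f s := by
  rw [rightTranslate, c0Pairing_toL1, integral_mul_rightTranslateFun, c0Conv_apply]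
  refine integral_congr_ae ?_
  filter_upwards [Integrable.coeFn_toL1 (μ := (Measure.haar : Measure G))
    (hc.integrable_of_hasCompactSupport hs)] with x hx
  rw [hx, mul_comm]

lemma exists_l1ToRegMeasure_eq_of_compactSupport {a : G → ℂ} (hc : Continuous a)
    (hs : HasCompactSupport a) (m : RegMeasure G) :
    ∃ b : GroupL1 G, l1ToRegMeasure Measure.haar b = l1ToRegMeasure Measure.haar
      ((hc.integrable_of_hasCompactSupport hs).toL1 a) * m := by
  let B : GroupL1 G →L[ℝ] ℂ →L[ℝ] GroupL1 G := (ContinuousLinearMap.lsmul ℝ ℂ).flip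
  -- The witness is `a * m = ∫ a * δ_s dm(s)`, an `L¹(G)`-valued integral of a bounded
  -- norm-continuous function; `B` multiplies a vector by a complex value of `m`.
  refine ⟨m.1.integral (rightTranslate hc hs) B, (RegMeasure.riesz G).injective ?_⟩
  ext f
  rw [riesz_l1_mul, riesz_l1ToRegMeasure, RegMeasure.riesz_apply]
  let C : GroupL1 G →L[ℝ] ℂ := (c0Pairing Measure.haar f).restrictScalars ℝ
  have hi : Integrable (rightTranslate hc hs) m.1.variation :=
    integrable_of_continuous_of_bounded _ (continuous_rightTranslate hc hs)
      fun s => (norm_rightTranslate hc hs s).le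
  have h1 := VectorMeasure.continuousLinearMap_apply_integral (μ := m.1) (B := B) (C := C) hi
  have h2 := VectorMeasure.integral_continuousLinearMap_comp (μ := m.1)
    (B := ContinuousLinearMap.mul ℝ ℂ) (C := C) hi
  have h3 : cIntegral m.1 (c0Conv ((hc.integrable_of_hasCompactSupport hs).toL1 a) f) =
      m.1.integral (fun s => C (rightTranslate hc hs s)) (ContinuousLinearMap.mul ℝ ℂ) := by
    rw [cIntegral]
    congr 1
    ext s
    exact (c0Pairing_rightTranslate hc hs f s).symm
  rw [h3, h2]
  refine h1.trans ?_
  congr 1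
  ext x z
  change c0Pairing Measure.haar f (z • x) = c0Pairing Measure.haar f x * z
  rw [map_smul, smul_eq_mul, mul_comm]

/-- `L¹(G)` is a right ideal of `M(G)`. -/
lemma exists_l1ToRegMeasure_eq_mul (a : GroupL1 G) (m : RegMeasure G) :
    ∃ b : GroupL1 G, l1ToRegMeasure Measure.haar b = l1ToRegMeasure Measure.haar a * m := by
  -- The image of `L¹(G)` is closed, being isometric to a complete space, so density of the
  -- compactly supported continuous functions suffices.
  have hcl : IsClosed {a : GroupL1 G | l1ToRegMeasure Measure.haar a * m ∈
      Set.range (l1ToRegMeasure (Measure.haar : Measure G))} :=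
    (l1ToRegMeasure Measure.haar).isometry.isClosedEmbedding.isClosed_range.preimage
      ((l1ToRegMeasure Measure.haar).continuous.mul continuous_const)
  refine hcl.closure_subset (Metric.mem_closure_iff.2 fun ε hε => ?_)
  obtain ⟨h, hc, hs, hah⟩ := L1.exists_compactSupport_norm_sub_le Measure.haar a (half_pos hε)
  refine ⟨_, exists_l1ToRegMeasure_eq_of_compactSupport hc hs m, ?_⟩
  rw [dist_eq_norm]
  exact hah.trans_lt (half_lt_self hε)

end Convolution

/-! ### A bounded right approximate identity of `L¹(G)` and the mixed identity. -/

section ApproximateIdentity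

variable {G : Type u} [Group G] [TopologicalSpace G] [IsTopologicalGroup G]
  [LocallyCompactSpace G] [T2Space G] [MeasurableSpace G] [BorelSpace G]

/-- The normalised indicator of the interior of a compact neighbourhood inside `U`: an open set has
positive measure, and compactness makes it finite. -/
lemma exists_l1_concentrated {U : Set G} (hU : U ∈ 𝓝 (1 : G)) :
    ∃ e : GroupL1 G, ‖e‖ = 1 ∧ ∫ x, e x ∂(Measure.haar : Measure G) = 1 ∧
      ∀ᵐ x ∂(Measure.haar : Measure G), x ∉ U → e x = 0 := by
  obtain ⟨K, hK, hKU, hKc⟩ := local_compact_nhds hU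
  have hfin : (Measure.haar : Measure G) (interior K) ≠ ∞ :=
    ((measure_mono interior_subset).trans_lt hKc.measure_lt_top).ne
  have hpos : 0 < (Measure.haar : Measure G).real (interior K) :=
    ENNReal.toReal_pos (isOpen_interior.measure_pos _ ⟨1, mem_interior_iff_mem_nhds.2 hK⟩).ne' hfin
  have hm : MeasurableSet (interior K) := isOpen_interior.measurableSet
  let c : ℂ := (((Measure.haar : Measure G).real (interior K))⁻¹ : ℝ)
  have hae := indicatorConstLp_coeFn (p := 1) (hs := hm) (hμs := hfin) (c := c)
  refine ⟨indicatorConstLp 1 hm hfin c, ?_, ?_, ?_⟩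
  · rw [norm_indicatorConstLp one_ne_zero ENNReal.one_ne_top]
    simp only [c, Complex.norm_real, norm_inv, Real.norm_eq_abs, abs_of_pos hpos,
      ENNReal.toReal_one, div_one, Real.rpow_one]
    exact inv_mul_cancel₀ hpos.ne'
  · rw [integral_congr_ae hae, integral_indicator_const _ hm, Complex.real_smul]
    simp only [c]
    rw [← Complex.ofReal_mul, mul_inv_cancel₀ hpos.ne', Complex.ofReal_one]
  · filter_upwards [hae] with x hx hxU
    rw [hx, Set.indicator_of_notMem fun h => hxU (hKU (interior_subset h))]

/-- An approximate identity of `L¹(G)`, indexed by the open neighbourhoods of `1`. -/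
def l1Approx (U : TopologicalSpace.OpenNhdsOf (1 : G)) : GroupL1 G :=
  (exists_l1_concentrated (U.isOpen.mem_nhds U.mem)).choose

lemma norm_l1Approx (U : TopologicalSpace.OpenNhdsOf (1 : G)) : ‖l1Approx U‖ = 1 :=
  (exists_l1_concentrated (U.isOpen.mem_nhds U.mem)).choose_spec.1

lemma integral_l1Approx (U : TopologicalSpace.OpenNhdsOf (1 : G)) :
    ∫ x, l1Approx U x ∂(Measure.haar : Measure G) = 1 :=
  (exists_l1_concentrated (U.isOpen.mem_nhds U.mem)).choose_spec.2.1

lemma l1Approx_ae_eq_zero (U : TopologicalSpace.OpenNhdsOf (1 : G)) :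
    ∀ᵐ x ∂(Measure.haar : Measure G), x ∉ U → l1Approx U x = 0 :=
  (exists_l1_concentrated (U.isOpen.mem_nhds U.mem)).choose_spec.2.2

/-- The weights have total mass one and live where `F` is close to `F 1`. The filter is `atBot`
because neighbourhoods shrink. Scalar `F` gives the point mass on `C₀(G)`; the orbit of right
translates gives the approximate identity. -/
lemma tendsto_integral_l1Approx_smul {E : Type*} [NormedAddCommGroup E] [NormedSpace ℂ E]
    [CompleteSpace E] {F : G → E} (hF : Continuous F) {C : ℝ} (hC : ∀ x, ‖F x‖ ≤ C) :
    Tendsto (fun U => ∫ x, l1Approx U x • F x ∂(Measure.haar : Measure G)) atBot (𝓝 (F 1)) := by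
  rw [Metric.tendsto_nhds]
  intro ε hε
  obtain ⟨W, hWs, hW, h1W⟩ := mem_nhds_iff.1 (Metric.continuousAt_iff'.1
    (hF.continuousAt (x := 1)) (ε / 2) (half_pos hε))
  filter_upwards [eventually_le_atBot
    (⟨⟨W, hW⟩, h1W⟩ : TopologicalSpace.OpenNhdsOf (1 : G))] with U hU
  have hi := integrable_smul_of_continuous Measure.haar (L1.integrable_coeFn (l1Approx U)) hF hC
  have hi1 : Integrable (fun x => l1Approx U x • F 1) (Measure.haar : Measure G) :=
    (L1.integrable_coeFn (l1Approx U)).smul_const _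
  have hdiff : ∫ x, l1Approx U x • F x ∂(Measure.haar : Measure G) - F 1 =
      ∫ x, (l1Approx U x • F x - l1Approx U x • F 1) ∂(Measure.haar : Measure G) := by
    rw [integral_sub hi hi1, integral_smul_const, integral_l1Approx, one_smul]
  rw [dist_eq_norm, hdiff]
  refine lt_of_le_of_lt ?_ (half_lt_self hε)
  calc _ ≤ ∫ x, ‖l1Approx U x‖ * (ε / 2) ∂(Measure.haar : Measure G) := by
        refine norm_integral_le_of_norm_le
          ((L1.integrable_coeFn (l1Approx U)).norm.mul_const _) ?_
        filter_upwards [l1Approx_ae_eq_zero U] with x hx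
        by_cases hxU : x ∈ U
        · rw [← smul_sub, norm_smul]
          have : dist (F x) (F 1) < ε / 2 := hWs (hU hxU)
          rw [dist_eq_norm] at this
          gcongr
        · simp [hx hxU]
    _ = ε / 2 := by
        rw [integral_mul_const, ← L1.norm_eq_integral_norm, norm_l1Approx, one_mul]

lemma tendsto_c0Pairing_l1Approx (f : C₀(G, ℂ)) :
    Tendsto (fun U => c0Pairing Measure.haar f (l1Approx U)) atBot (𝓝 (f 1)) := by
  refine (tendsto_integral_l1Approx_smul (map_continuous f) (c0_bound f)).congr fun U => ?_
  rw [c0Pairing_apply]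
  simp only [smul_eq_mul, mul_comm]

/-- Right convolution is an average of right translates; the two sides have the same pairing with
each `f` in `C₀(G)`. -/
lemma integral_smul_rightTranslate {a : G → ℂ} (hc : Continuous a) (hs : HasCompactSupport a)
    (e : GroupL1 G) : ∫ t, e t • rightTranslate hc hs t ∂(Measure.haar : Measure G) =
      (hc.integrable_of_hasCompactSupport hs).toL1 a * e := by
  refine eq_of_forall_c0Pairing_eq Measure.haar fun f => ?_
  rw [c0Pairing_mul, c0Pairing_apply _ (c0Conv _ _),
    ← (c0Pairing Measure.haar f).integral_comp_comm (integrable_smul_of_continuous _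
      (L1.integrable_coeFn e) (continuous_rightTranslate hc hs)
      fun s => (norm_rightTranslate hc hs s).le)]
  simp only [map_smul, smul_eq_mul, c0Pairing_rightTranslate, mul_comm]

lemma tendsto_mul_l1Approx (a : GroupL1 G) :
    Tendsto (fun U => a * l1Approx U) atBot (𝓝 a) := by
  rw [Metric.tendsto_nhds]
  intro ε hε
  obtain ⟨h, hc, hs, hah⟩ := L1.exists_compactSupport_norm_sub_le Measure.haar a
    (ε := ε / 4) (by positivity)
  have hlim := tendsto_integral_l1Approx_smul (continuous_rightTranslate hc hs)
    fun s => (norm_rightTranslate hc hs s).le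
  rw [rightTranslate_one] at hlim
  filter_upwards [Metric.tendsto_nhds.1 hlim (ε / 4) (by positivity)] with U hU
  set b : GroupL1 G := (hc.integrable_of_hasCompactSupport hs).toL1 h
  replace hU : ‖b * l1Approx U - b‖ < ε / 4 := by
    rw [← dist_eq_norm, ← integral_smul_rightTranslate hc hs]
    exact hU
  rw [dist_eq_norm]
  have h1 : ‖(a - b) * l1Approx U‖ ≤ ‖a - b‖ := by
    simpa [norm_l1Approx] using norm_mul_le (a - b) (l1Approx U)
  -- Each of the three terms has norm at most `ε / 4`, the first because `l1Approx U` has norm one.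
  have h2 : a * l1Approx U - a = (a - b) * l1Approx U + (b * l1Approx U - b) - (a - b) := by
    rw [sub_mul]
    abel
  rw [h2]
  have h3 := norm_sub_le ((a - b) * l1Approx U + (b * l1Approx U - b)) (a - b)
  have h4 := norm_add_le ((a - b) * l1Approx U) (b * l1Approx U - b)
  linarith

variable (G) in
/-- `L¹(G)**` has a mixed identity that restricts to the point mass at `1` on `C₀(G)`. -/
lemma exists_mixed_identity : ∃ E : StrongDual ℂ (StrongDual ℂ (GroupL1 G)),
    (∀ φ a, E (dualRight φ a) = φ a) ∧ ∀ f, E (c0Pairing Measure.haar f) = f 1 := by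
  obtain ⟨E, hE⟩ := exists_bidual_forall_eq_of_tendsto
    (atBot : Filter (TopologicalSpace.OpenNhdsOf (1 : G))) l1Approx fun U => (norm_l1Approx U).le
  exact ⟨E, fun φ a => hE _ _ ((φ.continuous.tendsto a).comp (tendsto_mul_l1Approx a)),
    fun f => hE _ _ (tendsto_c0Pairing_l1Approx f)⟩

end ApproximateIdentity

/-! ### Restriction to `C₀(G)` as a homomorphism onto `M(G)`. -/

section Restriction

variable {G : Type u} [Group G] [TopologicalSpace G] [IsTopologicalGroup G]
  [LocallyCompactSpace G] [T2Space G] [MeasurableSpace G] [BorelSpace G]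

variable (G) in
/-- Restriction of functionals on `L¹(G)*` to `C₀(G)`. -/
def bidualRestrict : ArensBidual (GroupL1 G) →L[ℂ] RegMeasure G :=
  (RegMeasure.riesz G).symm.toContinuousLinearEquiv.toContinuousLinearMap ∘L
    ((ContinuousLinearMap.compL ℂ C₀(G, ℂ) (StrongDual ℂ (GroupL1 G)) ℂ).flip
      (c0Pairing Measure.haar)) ∘L
    (ArensBidual.toDual (A := GroupL1 G)).toContinuousLinearEquiv.toContinuousLinearMap

lemma riesz_bidualRestrict (m : ArensBidual (GroupL1 G)) (f : C₀(G, ℂ)) :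
    RegMeasure.riesz G (bidualRestrict G m) f =
      ArensBidual.toDual m (c0Pairing Measure.haar f) :=
  DFunLike.congr_fun ((RegMeasure.riesz G).apply_symm_apply
    ((ArensBidual.toDual m).comp (c0Pairing Measure.haar))) f

/-- `C₀(G)` is stable under the right action of `L¹(G)`, so `n · f` depends only on the restriction
of `n` to `C₀(G)`. -/
lemma dualRight_c0Pairing (f : C₀(G, ℂ)) (a : GroupL1 G) :
    dualRight (c0Pairing Measure.haar f) a = c0Pairing Measure.haar (c0Conv a f) := by
  ext b
  exact c0Pairing_mul f a b

/-- With `ν` the restriction of `n`, both sides at `a` equal `∫ f d(a * ν)`. The Arens action thus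
becomes the slice operator that defines convolution of measures. -/
lemma bidualAct_c0Pairing (n : ArensBidual (GroupL1 G)) (f : C₀(G, ℂ)) :
    bidualAct (ArensBidual.toDual n) (c0Pairing Measure.haar f) =
      c0Pairing Measure.haar ((bidualRestrict G n).sliceL f) := by
  ext a
  rw [bidualAct_apply, dualRight_c0Pairing, ← riesz_bidualRestrict, ← riesz_l1_mul,
    RegMeasure.riesz_mul, ContinuousLinearMap.comp_apply, riesz_l1ToRegMeasure]

lemma bidualRestrict_mul (m n : ArensBidual (GroupL1 G)) :
    bidualRestrict G (m * n) = bidualRestrict G m * bidualRestrict G n :=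
  (RegMeasure.riesz G).injective <| by
    ext f
    rw [RegMeasure.riesz_mul, ContinuousLinearMap.comp_apply, riesz_bidualRestrict,
      riesz_bidualRestrict, ArensBidual.toDual_mul, bidualAct_c0Pairing]

/-- Right multiplication by `m` is dual to slicing by `m`, and the slice of `f` at `1` is `∫ f dm`.
-/
lemma bidualRestrict_bidualEmbed {E : StrongDual ℂ (StrongDual ℂ (GroupL1 G))}
    (hE : ∀ f, E (c0Pairing Measure.haar f) = f 1) (m : RegMeasure G) :
    bidualRestrict G (bidualEmbed (l1ToRegMeasure Measure.haar) exists_l1ToRegMeasure_eq_mul E m) =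
      m :=
  (RegMeasure.riesz G).injective <| by
    ext f
    have h : (c0Pairing Measure.haar f).comp (rightIdealAct (l1ToRegMeasure Measure.haar)
        exists_l1ToRegMeasure_eq_mul m) = c0Pairing Measure.haar (m.sliceL f) := by
      ext a
      rw [ContinuousLinearMap.comp_apply, ← riesz_l1ToRegMeasure, map_rightIdealAct,
        RegMeasure.riesz_mul, ContinuousLinearMap.comp_apply, riesz_l1ToRegMeasure]
    rw [riesz_bidualRestrict, toDual_bidualEmbed, h, hE, RegMeasure.sliceL_apply,
      RegMeasure.riesz_apply]
    simp only [one_mul]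

end Restriction

theorem mainTheorem1 (G : Type u) [Group G] [TopologicalSpace G] [IsTopologicalGroup G]
    [LocallyCompactSpace G] [T2Space G] [MeasurableSpace G] [BorelSpace G]
    (h : ApproxWeaklyAmenable (ArensBidual (GroupL1 G))) :
    ApproxWeaklyAmenable (RegMeasure G) := by
  obtain ⟨E, hE, hE'⟩ := exists_mixed_identity G
  exact h.of_retract
    (bidualEmbed (l1ToRegMeasure Measure.haar) exists_l1ToRegMeasure_eq_mul E) (bidualRestrict G)
    (bidualEmbed_mul _ _ l1ToRegMeasure_mul E hE) bidualRestrict_mul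
    (bidualRestrict_bidualEmbed hE')
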